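/- All vector spaces are finite-dimensional over an arbitrary (commutative) field $\mathbb{K}$. A linear subspace $\mathcal{S}$ of the space $\mathcal{L}(U,V)$ of linear maps from $U$ to $V$ is *reduced* if $\bigcap_{f\in\mathcal{S}}\ker f=\{0\}$ and $\sum_{f\in\mathcal{S}}\operatorname{im} f=V$. Its *upper-rank* is $\operatorname{urk}\mathcal{S}=\max_{f\in\mathcal{S}}\operatorname{rk} f$, and its *transitive rank* is $\operatorname{trk}\mathcal{S}=\max_{x\in U}\dim\mathcal{S}x$, where $\mathcal{S}x=\{f(x)\mid f\in\mathcal{S}\}$. For a non-negative integer $c$, $\mathcal{S}$ is *$c$-defective* if $\dim\ker f\ge c$ for all $f\in\mathcal{S}$, and *defective* if it is $1$-defective. It is *semi-primitive* if it is reduced and, $c$ being the greatest integer for which $\mathcal{S}$ is $c$-defective, there is no linear hyperplane $U'$ of $U$ such that $\{f_{|U'}\mid f\in\mathcal{S}\}$ is $c$-defective. For a positive integer $c$, $\mathcal{S}$ is *$c$-LLD* (locally linearly dependent) if $\dim\{f\in\mathcal{S}\mid f(x)=0\}\ge c$ for all $x\in U$, and *minimal $c$-LLD* if it is minimal for inclusion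 among the $c$-LLD linear subspaces of $\mathcal{L}(U,V)$. These notions apply to linear subspaces of the space $\mathrm{M}_{m,n}(\mathbb{K})$ of $m\times n$ matrices through the standard identification $\mathrm{M}_{m,n}(\mathbb{K})\simeq\mathcal{L}(\mathbb{K}^n,\mathbb{K}^m)$. A linear subspace $\mathcal{S}$ of $\mathrm{M}_{m,n}(\mathbb{K})$ has the *column property* if, for all integers $0\le p\le m$ and $1\le q\le n$ and every space $\mathcal{S}'=P\mathcal{S}Q$, with $P\in\mathrm{GL}_m(\mathbb{K})$ and $Q\in\mathrm{GL}_n(\mathbb{K})$, in which every matrix has the form $$M=\begin{bmatrix} [?]_{p\times q} & [?]_{p\times(n-q)}\\ B(M) & [0]_{(m-p)\times(n-q)}\end{bmatrix},\qquad B(M)\in\mathrm{M}_{m-p,q}(\mathbb{K}),$$ the space $\{B(M)\mid M\in\mathcal{S}'\}$ is defective. **Theorem.** Let $\mathcal{S}$ be a reduced linear subspace of $\mathrm{M}_{m,n}(\mathbb{K})$. Set $r:=\operatorname{urk}\mathcal{S}$ and assume that $\#\mathbb{K}>r\ge 2$. (a) If $\mathcal{S}$ has the column property and $r\ge 4$,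 then $\operatorname{trk}\mathcal{S}\le\binom{r}{2}$. (b) If $\mathcal{S}$ is semi-primitive, then $\operatorname{trk}\mathcal{S}\le 3+\binom{r-1}{2}$. **Corollary.** Let $c$ be a positive integer and let $\mathcal{S}\subset\mathcal{L}(U,V)$ be a minimal $c$-LLD operator space with dimension $n$. Assume that $\#\mathbb{K}>n-c\ge 2$. Then $\operatorname{urk}\mathcal{S}\le 3+\binom{n-c-1}{2}$. -/

import Mathlib

namespace OpSpace

open Module

section Operators

variable {K U V : Type*} [Field K] [AddCommGroup U] [Module K U] [AddCommGroup V] [Module K V]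

/-- A linear subspace `S` of `L(U,V)` is reduced when the operators in `S` have no common non-zero
zero, and the sum of their ranges is `V`. -/
def IsReduced (S : Submodule K (U →ₗ[K] V)) : Prop :=
  (⨅ f ∈ S, LinearMap.ker f) = ⊥ ∧ (⨆ f ∈ S, LinearMap.range f) = ⊤

/-- The upper-rank of `S`: the maximal rank of an operator in `S` (the set of these ranks is
non-empty, and bounded by `dim V` if `V` is finite-dimensional). -/
noncomputable def urk (S : Submodule K (U →ₗ[K] V)) : ℕ :=
  sSup {k : ℕ | ∃ f ∈ S, finrank K (LinearMap.range f) = k}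

/-- The space `S x = {f x | f ∈ S}`. -/
def orbit (S : Submodule K (U →ₗ[K] V)) (x : U) : Submodule K V :=
  S.map (LinearMap.applyₗ x)

/-- The transitive rank of `S`: the maximal dimension of `S x` for `x` in `U`. -/
noncomputable def trk (S : Submodule K (U →ₗ[K] V)) : ℕ :=
  sSup {k : ℕ | ∃ x : U, finrank K (orbit S x) = k}

/-- `S` is `c`-locally linearly dependent: for each `x`, the space `{f ∈ S | f x = 0}` has
dimension at least `c`. -/
def IsLLD (c : ℕ) (S : Submodule K (U →ₗ[K] V)) : Prop :=
  ∀ x : U, c ≤ finrank K ↥(S ⊓ LinearMap.ker (LinearMap.applyₗ x : (U →ₗ[K] V) →ₗ[K] V))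

/-- `S` is `c`-defective: the kernel of each operator in `S` has dimension at least `c`. -/
def IsDefective (c : ℕ) (S : Submodule K (U →ₗ[K] V)) : Prop :=
  ∀ f ∈ S, c ≤ finrank K (LinearMap.ker f)

/-- The space of all restrictions to `U'` of the operators in `S`. -/
def restrict (U' : Submodule K U) (S : Submodule K (U →ₗ[K] V)) : Submodule K (U' →ₗ[K] V) :=
  S.map (LinearMap.domRestrict' U')

/-- `S` is semi-primitive: it is reduced and, `c` being its defectiveness index (so that `S` is
`c`-defective but not `(c+1)`-defective), there is no linear hyperplane `U'` of `U` such that the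
space of restrictions of `S` to `U'` is `c`-defective. -/
def IsSemiPrimitive (S : Submodule K (U →ₗ[K] V)) : Prop :=
  IsReduced S ∧ ∃ c : ℕ, IsDefective c S ∧ ¬ IsDefective (c + 1) S ∧
    ∀ U' : Submodule K U, finrank K U' + 1 = finrank K U → ¬ IsDefective c (restrict U' S)

end Operators

section Matrices

variable {K : Type*} [Field K]

/-- The operator space attached to a linear subspace of matrices, under the standard
identification of matrices with linear maps from `K^n` to `K^m`. -/
def ofMatrices {ι κ : Type*} [Fintype κ] [DecidableEq κ] (S : Submodule K (Matrix ι κ K)) :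
    Submodule K ((κ → K) →ₗ[K] (ι → K)) :=
  S.map (Matrix.toLin' : Matrix ι κ K ≃ₗ[K] ((κ → K) →ₗ[K] (ι → K))).toLinearMap

/-- Equivalence of matrix spaces: `S = P S' Q` for non-singular matrices `P` and `Q`. -/
def MatEquiv {m n : ℕ} (S S' : Submodule K (Matrix (Fin m) (Fin n) K)) : Prop :=
  ∃ (P : GL (Fin m) K) (Q : GL (Fin n) K),
    (S : Set (Matrix (Fin m) (Fin n) K)) =
      (fun M : Matrix (Fin m) (Fin n) K => P.val * M * Q.val) '' (S' : Set (Matrix (Fin m) (Fin n) K))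

/-- `S` is `(p,q)`-decomposed: in each matrix of `S` the lower right block, with rows from the
`(p+1)`-st on and columns from the `(q+1)`-st on, is zero. -/
def IsDecomposed {m n : ℕ} (p q : ℕ) (S : Submodule K (Matrix (Fin m) (Fin n) K)) : Prop :=
  ∀ M ∈ S, ∀ (i : Fin m) (j : Fin n), p ≤ i.val → q ≤ j.val → M i j = 0

/-- Extraction of the lower left block, with the last `m - p` rows and the first `q` columns. -/
def lowerBlock (K : Type*) [Field K] (m n p q : ℕ) :
    Matrix (Fin m) (Fin n) K →ₗ[K]
      Matrix {i : Fin m // p ≤ i.val} {j : Fin n // j.val < q} K where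
  toFun M := M.submatrix Subtype.val Subtype.val
  map_add' _ _ := rfl
  map_smul' _ _ := rfl

/-- The lower space of a `(p,q)`-decomposed matrix space. -/
def lowerSpace {m n : ℕ} (p q : ℕ) (S : Submodule K (Matrix (Fin m) (Fin n) K)) :
    Submodule K (Matrix {i : Fin m // p ≤ i.val} {j : Fin n // j.val < q} K) :=
  S.map (lowerBlock K m n p q)

/-- The column property: for all `0 ≤ p ≤ m` and `1 ≤ q ≤ n`, each `(p,q)`-decomposed space that
is equivalent to `S` has a defective lower space (no matrix in it has a trivial kernel). -/
def HasColumnProperty {m n : ℕ} (S : Submodule K (Matrix (Fin m) (Fin n) K)) : Prop :=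
  ∀ p q : ℕ, p ≤ m → 1 ≤ q → q ≤ n →
    ∀ S' : Submodule K (Matrix (Fin m) (Fin n) K), MatEquiv S' S → IsDecomposed p q S' →
      IsDefective 1 (ofMatrices (lowerSpace p q S'))

end Matrices

end OpSpace

/-! A space of operators is treated as a linear family `Φ : E →ₗ[K] U →ₗ[K] V`, so that `Φ.flip x`
is evaluation at `x` and the transitive rank is the largest `rk (Φ.flip x)`. Let `r` be the
upper-rank, and call `z` good if some `Φ e₀` of rank `r` kills it. No pencil `Φ e₀ + t • Φ e`
exceeds rank `r`; over an infinite field this forces `Φ e z ∈ range (Φ e₀)` for all `e`, together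
with conditions of order two and three (`apply_mem_range₁`, `apply_mem_range₂`, `apply_mem_range₃`).
Hence `rk (Φ.flip z) ≤ r`.

Semi-primitivity makes the good vectors span `U`. This survives in `V ⧸ range (Φ.flip z)`, where the
upper-rank is smaller if `Φ.flip z ≠ 0` (`SemiPrim.exists_semiPrim_quot`), and induction bounds the
sum of the ranges by `r + (r - 1) + ⋯ + 1`.

For the sharper bound on `rk (Φ.flip x)`, take `z` good with `s = rk (Φ.flip z) ≠ 0`. If `s ≤ r -
2`, induction suffices. If `s = r`, the conditions of order two and three give a bound of about
`3r/2`. If `s = r - 1` for all such `z`, either some quotient has upper-rank below `r - 1` and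
induction suffices again, or `SemiPrim.exists_pair` yields two operators in general position. Modulo
`range (Φ.flip z)`, the second has a kernel vector of full evaluation rank and the first has rank
one, which improves the direct estimate by just enough (`SemiPrim.rk_flip_le_of_pair`).

Small fields are handled by extending scalars to the algebraic closure: `#K > r` keeps the
upper-rank unchanged. Under the column property, a subspace `W` on which the family is
semi-primitive is split off, and the quotient by its images loses one extra unit of rank
(`ColProp.finrank_total_le`). The corollary is the semi-primitive bound for the dual family `x ↦ (f
↦ f x)`. -/

namespace OpSpace

open Module LinearMap Polynomial

/-! ### Polynomial curves and generic linear independence. -/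

section Curves

variable {K : Type*} [Field K] {V W : Type*} [AddCommGroup V] [Module K V]
  [AddCommGroup W] [Module K W]

/-- Polynomial functions on `K`. -/
def IsPolyFun (F : K → K) : Prop := ∃ p : K[X], ∀ t, F t = p.eval t

/-- Curves all of whose coordinates are polynomial functions. -/
def IsPolyCurve (v : K → V) : Prop := ∀ ℓ : V →ₗ[K] K, IsPolyFun fun t => ℓ (v t)

namespace IsPolyFun

theorem const (c : K) : IsPolyFun fun _ => c := ⟨C c, by simp⟩

theorem id : IsPolyFun fun t : K => t := ⟨X, by simp⟩

theorem add {F G : K → K} (hF : IsPolyFun F) (hG : IsPolyFun G) : IsPolyFun fun t => F t + G t := by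
  obtain ⟨p, hp⟩ := hF
  obtain ⟨q, hq⟩ := hG
  exact ⟨p + q, by simp [hp, hq]⟩

theorem mul {F G : K → K} (hF : IsPolyFun F) (hG : IsPolyFun G) : IsPolyFun fun t => F t * G t := by
  obtain ⟨p, hp⟩ := hF
  obtain ⟨q, hq⟩ := hG
  exact ⟨p * q, by simp [hp, hq]⟩

theorem sum {ι : Type*} (s : Finset ι) {F : ι → K → K} (hF : ∀ i, IsPolyFun (F i)) :
    IsPolyFun fun t => ∑ i ∈ s, F i t := by
  choose p hp using hF
  exact ⟨∑ i ∈ s, p i, by simp [hp, eval_finsetSum]⟩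

theorem prod {ι : Type*} (s : Finset ι) {F : ι → K → K} (hF : ∀ i, IsPolyFun (F i)) :
    IsPolyFun fun t => ∏ i ∈ s, F i t := by
  choose p hp using hF
  exact ⟨∏ i ∈ s, p i, by simp [hp, eval_prod]⟩

theorem comp_one_sub {F : K → K} (hF : IsPolyFun F) : IsPolyFun fun t => F (1 - t) := by
  obtain ⟨p, hp⟩ := hF
  exact ⟨p.comp (1 - X), by simp [hp]⟩

theorem det {ι : Type*} [Fintype ι] [DecidableEq ι] {N : K → Matrix ι ι K}
    (hN : ∀ i j, IsPolyFun fun t => N t i j) : IsPolyFun fun t => (N t).det := by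
  simp only [Matrix.det_apply']
  exact sum _ fun σ => (const _).mul (prod _ fun i => hN _ _)

theorem adjugate {ι : Type*} [Fintype ι] [DecidableEq ι] {N : K → Matrix ι ι K}
    (hN : ∀ i j, IsPolyFun fun t => N t i j) (i j : ι) :
    IsPolyFun fun t => (N t).adjugate i j := by
  simp only [Matrix.adjugate_apply]
  refine det fun a b => ?_
  by_cases h : a = j
  · subst h
    simpa using const _
  · simpa [Matrix.updateRow_ne h] using hN a b

theorem finite_zeros {F : K → K} (hF : IsPolyFun F) {t₀ : K} (h : F t₀ ≠ 0) :
    {t | F t = 0}.Finite := by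
  obtain ⟨p, hp⟩ := hF
  have hp0 : p ≠ 0 := by
    rintro rfl
    simp [hp] at h
  refine (p.rootSet_finite K).subset fun t ht => ?_
  simp only [Set.mem_ofPred_eq, hp] at ht
  simp [mem_rootSet, hp0, ht]

end IsPolyFun

namespace IsPolyCurve

theorem const (v : V) : IsPolyCurve fun _ : K => v := fun ℓ => .const (ℓ v)

theorem add {v w : K → V} (hv : IsPolyCurve v) (hw : IsPolyCurve w) :
    IsPolyCurve fun t => v t + w t := fun ℓ => by
  simpa using (hv ℓ).add (hw ℓ)

theorem smul {F : K → K} {v : K → V} (hF : IsPolyFun F) (hv : IsPolyCurve v) :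
    IsPolyCurve fun t => F t • v t := fun ℓ => by
  simpa using hF.mul (hv ℓ)

theorem sub {v w : K → V} (hv : IsPolyCurve v) (hw : IsPolyCurve w) :
    IsPolyCurve fun t => v t - w t := by
  simpa [sub_eq_add_neg] using hv.add ((smul (.const (-1)) hw))

theorem sum {ι : Type*} (s : Finset ι) {v : ι → K → V} (hv : ∀ i, IsPolyCurve (v i)) :
    IsPolyCurve fun t => ∑ i ∈ s, v i t := fun ℓ => by
  simpa using IsPolyFun.sum s fun i => hv i ℓ

theorem map (A : V →ₗ[K] W) {v : K → V} (hv : IsPolyCurve v) : IsPolyCurve fun t => A (v t) :=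
  fun ℓ => hv (ℓ ∘ₗ A)

theorem comp_one_sub {v : K → V} (hv : IsPolyCurve v) : IsPolyCurve fun t => v (1 - t) :=
  fun ℓ => (hv ℓ).comp_one_sub

/-- The image of a polynomial curve under a pencil of linear maps. -/
theorem pencil (f g : V →ₗ[K] W) {v : K → V} (hv : IsPolyCurve v) :
    IsPolyCurve fun t => (f + t • g) (v t) := by
  simpa using (hv.map f).add (smul .id (hv.map g))

end IsPolyCurve

theorem exists_dual_family {ι : Type*} [Fintype ι] [DecidableEq ι] {v : ι → V}
    (hv : LinearIndependent K v) : ∃ ℓ : ι → V →ₗ[K] K, ∀ i j, ℓ i (v j) = if i = j then 1 else 0 := by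
  obtain ⟨g, hg⟩ := (Fintype.linearCombination K v).exists_leftInverse_of_injective
    (LinearMap.ker_eq_bot.2 hv.fintypeLinearCombination_injective)
  refine ⟨fun i => LinearMap.proj i ∘ₗ g, fun i j => ?_⟩
  have := LinearMap.congr_fun hg (Pi.single j 1)
  simp only [LinearMap.comp_apply, Fintype.linearCombination_apply_single, one_smul,
    LinearMap.id_apply] at this
  simp [this, Pi.single_apply]

theorem linearIndependent_of_det_ne_zero {ι : Type*} [Fintype ι] [DecidableEq ι] {v : ι → V}
    (ℓ : ι → V →ₗ[K] K) (h : (Matrix.of fun i j => ℓ i (v j)).det ≠ 0) : LinearIndependent K v := by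
  rw [Fintype.linearIndependent_iff]
  intro c hc
  have : (Matrix.of fun i j => ℓ i (v j)).mulVec c = 0 := by
    funext i
    have := congrArg (ℓ i) hc
    simpa [Matrix.mulVec, dotProduct, mul_comm] using this
  exact fun i => congrFun (Matrix.eq_zero_of_mulVec_eq_zero h this) i

/-- Linear independence is an open condition along polynomial curves. -/
theorem finite_not_linearIndependent {ι : Type*} [Finite ι] {v : ι → K → V}
    (hv : ∀ i, IsPolyCurve (v i)) {t₀ : K} (h : LinearIndependent K fun i => v i t₀) :
    {t | ¬ LinearIndependent K fun i => v i t}.Finite := by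
  classical
  have := Fintype.ofFinite ι
  obtain ⟨ℓ, hℓ⟩ := exists_dual_family h
  have hd : IsPolyFun fun t => (Matrix.of fun i j => ℓ i (v j t)).det :=
    IsPolyFun.det fun i j => hv j (ℓ i)
  have h1 : (Matrix.of fun i j => ℓ i (v j t₀)).det ≠ 0 := by
    have : (Matrix.of fun i j => ℓ i (v j t₀)) = 1 := by
      ext i j
      simp [hℓ, Matrix.one_apply]
    simp [this]
  refine (hd.finite_zeros h1).subset fun t ht => ?_
  by_contra h2
  exact ht (linearIndependent_of_det_ne_zero ℓ h2)

end Curves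

/-! ### Ranks in pencils and in quotients. -/

section Ranks

variable {K : Type*} [Field K] {U V : Type*} [AddCommGroup U] [Module K U]
  [AddCommGroup V] [Module K V]

/-- The rank of a linear map. -/
noncomputable abbrev rk (f : U →ₗ[K] V) : ℕ := finrank K (LinearMap.range f)

theorem exists_linearIndependent_of_finrank_eq {Y : Submodule K V} [FiniteDimensional K Y] {k : ℕ}
    (h : finrank K Y = k) : ∃ v : Fin k → V, LinearIndependent K v ∧ (∀ i, v i ∈ Y) ∧
      Submodule.span K (Set.range v) = Y := by
  have b := finBasisOfFinrankEq K Y h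
  refine ⟨fun i => b i, b.linearIndependent.map' Y.subtype (by simp), fun i => (b i).2, ?_⟩
  have := congrArg (Submodule.map Y.subtype) b.span_eq
  rw [Submodule.map_span, ← Set.range_comp, Submodule.map_top, Submodule.range_subtype] at this
  exact this

variable [FiniteDimensional K V]

theorem card_le_finrank_of_mem {k : ℕ} {v : Fin k → V} (hv : LinearIndependent K v)
    {Y : Submodule K V} (h : ∀ i, v i ∈ Y) : k ≤ finrank K Y := by
  have h1 : LinearIndependent K fun i => (⟨v i, h i⟩ : Y) :=
    LinearIndependent.of_comp Y.subtype hv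
  simpa using h1.fintype_card_le_finrank

theorem exists_lifts_of_rk_eq {f : U →ₗ[K] V} {k : ℕ} (h : rk f = k) :
    ∃ u : Fin k → U, LinearIndependent K (fun i => f (u i)) ∧
      Submodule.span K (Set.range fun i => f (u i)) = LinearMap.range f := by
  obtain ⟨v, hv, hm, hs⟩ := exists_linearIndependent_of_finrank_eq h
  choose u hu using hm
  refine ⟨u, ?_⟩
  simp only [hu]
  exact ⟨hv, hs⟩

theorem finite_rk_lt (f g : U →ₗ[K] V) : {t : K | rk (f + t • g) < rk f}.Finite := by
  obtain ⟨u, hu, -⟩ := exists_lifts_of_rk_eq (f := f) rfl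
  have := finite_not_linearIndependent (v := fun i t => (f + t • g) (u i)) (t₀ := 0)
    (fun i => IsPolyCurve.pencil f g (.const _)) (by simpa using hu)
  refine this.subset fun t ht hind => ?_
  exact absurd (card_le_finrank_of_mem hind (Y := LinearMap.range (f + t • g))
    fun i => ⟨_, rfl⟩) (not_le.2 ht)

theorem rk_mkQ_comp_add (f : U →ₗ[K] V) (Y : Submodule K V) :
    rk (Y.mkQ ∘ₗ f) + finrank K ↥(LinearMap.range f ⊓ Y) = rk f := by
  have h := (Y.mkQ.domRestrict (LinearMap.range f)).finrank_range_add_finrank_ker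
  rw [LinearMap.range_domRestrict, ← LinearMap.range_comp, LinearMap.ker_domRestrict,
    Submodule.ker_mkQ] at h
  have h2 : finrank K (Y.comap (LinearMap.range f).subtype) = finrank K ↥(LinearMap.range f ⊓ Y) := by
    rw [← Submodule.map_comap_subtype]
    exact (Submodule.equivMapOfInjective _ (LinearMap.range f).injective_subtype _).finrank_eq
  rw [← h2]
  exact h

end Ranks

end OpSpace

namespace OpSpace

open Module LinearMap Polynomial

/-! ### Pencils through an operator of maximal rank. -/

section Pencils

variable {K : Type*} [Field K] {U V : Type*} [AddCommGroup U] [Module K U]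
  [AddCommGroup V] [Module K V] [FiniteDimensional K V] {f g : U →ₗ[K] V}

/-- A kernel vector of an operator of maximal rank in a pencil extends to a polynomial curve of
kernel vectors. -/
theorem exists_kernel_curve (h : ∀ t : K, rk (f + t • g) ≤ rk f) {z : U} (hz : f z = 0) :
    ∃ w : K → U, IsPolyCurve w ∧ w 0 = z ∧ {t | (f + t • g) (w t) ≠ 0}.Finite := by
  classical
  obtain ⟨u, hu, hs⟩ := exists_lifts_of_rk_eq (f := f) rfl
  obtain ⟨ℓ, hℓ⟩ := exists_dual_family hu
  let N : K → Matrix (Fin (rk f)) (Fin (rk f)) K :=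
    fun t => Matrix.of fun i j => ℓ i ((f + t • g) (u j))
  let q : K → Fin (rk f) → K := fun t i => ℓ i ((f + t • g) z)
  have hN : ∀ i j, IsPolyFun fun t => N t i j := fun i j =>
    IsPolyCurve.pencil f g (.const (u j)) (ℓ i)
  have hq : ∀ i, IsPolyFun fun t => q t i := fun i => IsPolyCurve.pencil f g (.const z) (ℓ i)
  have hN0 : N 0 = 1 := by
    ext i j
    simp [N, hℓ, Matrix.one_apply]
  -- Cramer's rule: `z` is corrected by a combination of the `u i` so that all coordinates `ℓ i` of
  -- the image vanish; scaling by `det (N t)` keeps the curve polynomial.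
  refine ⟨fun t => (N t).det • z - ∑ i, ((N t).adjugate.mulVec (q t)) i • u i, ?_, ?_, ?_⟩
  · refine (IsPolyCurve.smul (IsPolyFun.det hN) (.const z)).sub (IsPolyCurve.sum _ fun i => ?_)
    refine IsPolyCurve.smul ?_ (.const _)
    exact IsPolyFun.sum Finset.univ fun j => (IsPolyFun.adjugate hN i j).mul (hq j)
  · have : q 0 = 0 := by
      funext i
      simp [q, hz]
    simp [hN0, this]
  · refine ((IsPolyFun.det hN).finite_zeros (t₀ := 0) (by simp [hN0])).subset fun t ht => ?_
    by_contra hdet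
    refine ht ?_
    set F := f + t • g with hF
    set w := (N t).det • z - ∑ i, ((N t).adjugate.mulVec (q t)) i • u i with hw
    -- When `det (N t) ≠ 0`, maximality of the rank makes the `F (u i)` span `range F`, so the
    -- coordinates `ℓ i` detect zero there.
    have hind : LinearIndependent K fun i => F (u i) := linearIndependent_of_det_ne_zero ℓ hdet
    have hspan : Submodule.span K (Set.range fun i => F (u i)) = LinearMap.range F := by
      refine Submodule.eq_of_le_of_finrank_le (Submodule.span_le.2 ?_) ?_
      · rintro _ ⟨i, rfl⟩
        exact ⟨u i, rfl⟩
      · rw [finrank_span_eq_card hind, Fintype.card_fin]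
        exact h t
    obtain ⟨c, hc⟩ := (Submodule.mem_span_range_iff_exists_fun K).1
      (hspan.symm ▸ LinearMap.mem_range_self F w)
    have hℓw : ∀ i, ℓ i (F w) = 0 := fun i => by
      have h1 : ∀ j, ℓ i (F (u j)) = N t i j := fun j => rfl
      have h2 : ℓ i (F z) = q t i := rfl
      have h3 : ((N t).mulVec ((N t).adjugate.mulVec (q t))) i = (N t).det * q t i := by
        rw [Matrix.mulVec_mulVec, Matrix.mul_adjugate, Matrix.smul_mulVec, Matrix.one_mulVec]
        rfl
      rw [hw]
      simp only [map_sub, map_smul, map_sum, h1, h2, smul_eq_mul, ← h3]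
      simp [Matrix.mulVec, dotProduct, mul_comm]
    have hc0 : (N t).mulVec c = 0 := by
      funext i
      have := hℓw i
      rw [← hc] at this
      simpa [Matrix.mulVec, dotProduct, N, mul_comm, hF, mul_add] using this
    rw [← hc, Matrix.eq_zero_of_mulVec_eq_zero hdet hc0]
    simp

variable [Infinite K]

/-- A `v` outside `range f` would stay independent of the images of lifted basis vectors for almost
all `t`, producing an operator of rank `rk f + 1`. -/
theorem mem_range_of_forall_mem_range_pencil (h : ∀ t : K, rk (f + t • g) ≤ rk f) {v : V}
    (hv : ∀ t : K, t ≠ 0 → v ∈ LinearMap.range (f + t • g)) : v ∈ LinearMap.range f := by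
  by_contra hvf
  obtain ⟨u, hu, hs⟩ := exists_lifts_of_rk_eq (f := f) rfl
  let c : Fin (rk f + 1) → K → V := Fin.cons (fun _ => v) fun i t => (f + t • g) (u i)
  have hc : ∀ t, (fun i => c i t) = Fin.cons v fun i => (f + t • g) (u i) := fun t => by
    funext i
    refine Fin.cases ?_ (fun i => ?_) i <;> simp [c]
  have hpoly : ∀ i, IsPolyCurve (c i) := fun i => by
    refine Fin.cases ?_ (fun i => ?_) i
    · simpa [c] using IsPolyCurve.const v
    · simpa only [c, Fin.cons_succ] using IsPolyCurve.pencil f g (.const _)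
  have h0 : LinearIndependent K fun i => c i 0 := by
    rw [hc, linearIndependent_finCons]
    simpa [hs] using ⟨hu, by simpa using hvf⟩
  have hfin := (finite_not_linearIndependent hpoly h0).union (Set.finite_singleton (0 : K))
  obtain ⟨t, ht⟩ := hfin.infinite_compl.nonempty
  simp only [Set.mem_compl_iff, Set.mem_union, Set.mem_ofPred_eq, Set.mem_singleton_iff,
    not_or, not_not] at ht
  have := card_le_finrank_of_mem ht.1 (Y := LinearMap.range (f + t • g)) fun i => by
    refine Fin.cases ?_ (fun i => ?_) i
    · simpa [c] using hv t ht.2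
    · exact ⟨u i, by simp [c]⟩
  exact absurd (h t) (not_le.2 this)

/-- This and the next two lemmas telescope truncated power series: for instance `(f + t • g) (u₀ - t
• u₁ + t ^ 2 • u₂) = t ^ 3 • g u₂`, so dividing by the power of `t` puts the last term in every
range with `t ≠ 0`. -/
theorem apply_mem_range₁ (h : ∀ t : K, rk (f + t • g) ≤ rk f) {u : U} (hu : f u = 0) :
    g u ∈ LinearMap.range f :=
  mem_range_of_forall_mem_range_pencil h fun t ht =>
    ⟨t⁻¹ • u, by simp [hu, smul_smul, ht]⟩

theorem apply_mem_range₂ (h : ∀ t : K, rk (f + t • g) ≤ rk f) {u₀ u₁ : U} (h₀ : f u₀ = 0)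
    (h₁ : f u₁ = g u₀) : g u₁ ∈ LinearMap.range f :=
  mem_range_of_forall_mem_range_pencil h fun t ht => by
    refine ⟨-(t⁻¹ ^ 2) • (u₀ - t • u₁), ?_⟩
    simp only [map_smul, LinearMap.add_apply, LinearMap.smul_apply, map_sub, h₀, h₁]
    match_scalars <;> field_simp
    ring

theorem apply_mem_range₃ (h : ∀ t : K, rk (f + t • g) ≤ rk f) {u₀ u₁ u₂ : U} (h₀ : f u₀ = 0)
    (h₁ : f u₁ = g u₀) (h₂ : f u₂ = g u₁) : g u₂ ∈ LinearMap.range f :=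
  mem_range_of_forall_mem_range_pencil h fun t ht => by
    refine ⟨(t⁻¹ ^ 3) • (u₀ - t • u₁ + t ^ 2 • u₂), ?_⟩
    simp only [map_smul, LinearMap.add_apply, LinearMap.smul_apply, map_sub, map_add, h₀, h₁, h₂]
    match_scalars <;> field_simp <;> ring

end Pencils

/-! ### Good vectors whose evaluation fills the range of a maximal-rank operator. -/

section FullColumn

variable {K : Type*} [Field K] {E U V : Type*}
  [AddCommGroup E] [Module K E] [AddCommGroup U] [Module K U]
  [AddCommGroup V] [Module K V]

/-- From `X` to `Y` the image under `ζ` grows by exactly `dim Y - dim X`, since `ker ζ ≤ X`; under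
`τ` it grows by at most that. -/
theorem finrank_map_add_le [FiniteDimensional K E] (τ ζ : E →ₗ[K] V) {X Y : Submodule K E}
    (hXY : X ≤ Y) (hζ : LinearMap.ker ζ ≤ X) :
    finrank K (Y.map τ) + finrank K (X.map ζ) ≤ finrank K (X.map τ) + finrank K (Y.map ζ) := by
  have key : ∀ (σ : E →ₗ[K] V) (Z : Submodule K E),
      finrank K (Z.map σ) + finrank K ↥(Z ⊓ LinearMap.ker σ) = finrank K Z := fun σ Z => by
    have h := (σ.domRestrict Z).finrank_range_add_finrank_ker
    rw [LinearMap.range_domRestrict, LinearMap.ker_domRestrict] at h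
    have h2 : finrank K ((LinearMap.ker σ).comap Z.subtype) = finrank K ↥(Z ⊓ LinearMap.ker σ) := by
      rw [← Submodule.map_comap_subtype]
      exact (Submodule.equivMapOfInjective _ Z.injective_subtype _).finrank_eq
    rw [← h2]
    exact h
  have h1 := key τ X
  have h2 := key τ Y
  have h3 := key ζ X
  have h4 := key ζ Y
  rw [inf_eq_right.2 hζ] at h3
  rw [inf_eq_right.2 (hζ.trans hXY)] at h4
  have h5 : finrank K ↥(X ⊓ LinearMap.ker τ) ≤ finrank K ↥(Y ⊓ LinearMap.ker τ) :=
    Submodule.finrank_mono (inf_le_inf_right _ hXY)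
  omega

/-- Growth is compared along `X ≤ Z ≤ ⊤`, where `Z = τ⁻¹(range ζ)`. The unknown `dim ζ(Z)` cancels
between the two comparisons once `τ(X) ≤ ζ(Z)` and `τ(Z) ≤ range ζ` are used. -/
theorem two_mul_finrank_range_add_le [FiniteDimensional K E] [FiniteDimensional K V]
    (τ ζ : E →ₗ[K] V) {X : Submodule K E} (hX : X ≤ (LinearMap.range ζ).comap τ)
    (hζ : LinearMap.ker ζ ≤ X) (hτ : X.map τ ≤ ((LinearMap.range ζ).comap τ).map ζ) :
    2 * finrank K (LinearMap.range τ) + finrank K (X.map ζ) ≤ 3 * finrank K (LinearMap.range ζ) := by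
  set Z := (LinearMap.range ζ).comap τ with hZ
  have h1 := finrank_map_add_le τ ζ hX hζ
  have h2 := finrank_map_add_le τ ζ (X := Z) (Y := ⊤) le_top (hζ.trans hX)
  rw [Submodule.map_top, Submodule.map_top] at h2
  have h3 : finrank K (Z.map τ) ≤ finrank K (LinearMap.range ζ) :=
    Submodule.finrank_mono (Submodule.map_comap_le _ _)
  have h4 : finrank K (X.map τ) ≤ finrank K (Z.map ζ) := Submodule.finrank_mono hτ
  omega

variable (Φ : E →ₗ[K] U →ₗ[K] V) {e₀ : E}

theorem rk_pencil_le (hr : ∀ e, rk (Φ e) ≤ rk (Φ e₀)) (e : E) (t : K) :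
    rk (Φ e₀ + t • Φ e) ≤ rk (Φ e₀) := by
  simpa using hr (e₀ + t • e)

variable [Infinite K] [FiniteDimensional K V]

theorem range_flip_le (hr : ∀ e, rk (Φ e) ≤ rk (Φ e₀)) {z : U} (hz : Φ e₀ z = 0) :
    LinearMap.range (Φ.flip z) ≤ LinearMap.range (Φ e₀) := by
  rintro _ ⟨e, rfl⟩
  exact apply_mem_range₁ (rk_pencil_le Φ hr e) hz

/-- Polarization of the second-order condition, which is quadratic in `e`. -/
theorem add_mem_range (hr : ∀ e, rk (Φ e) ≤ rk (Φ e₀)) {u₀ u₁ u₂ : U} (h₀ : Φ e₀ u₀ = 0)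
    {e e' : E} (h₁ : Φ e₀ u₁ = Φ e u₀) (h₂ : Φ e₀ u₂ = Φ e' u₀) :
    Φ e u₂ + Φ e' u₁ ∈ LinearMap.range (Φ e₀) := by
  have h3 := apply_mem_range₂ (rk_pencil_le Φ hr e) h₀ h₁
  have h4 := apply_mem_range₂ (rk_pencil_le Φ hr e') h₀ h₂
  have h5 := apply_mem_range₂ (rk_pencil_le Φ hr (e + e')) (u₁ := u₁ + u₂) h₀ (by simp [h₁, h₂])
  have := Submodule.sub_mem _ (Submodule.sub_mem _ h5 h3) h4
  convert this using 1
  simp only [map_add, LinearMap.add_apply]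
  abel

/-- If `Φ e z = Φ e₀ x`, fullness gives `e₂` with `Φ e₂ z = Φ e x`. Polarization applied to `e₂` and
`e`, minus the third-order condition for `e`, then puts `Φ e₂ x` in the range. This supplies the
hypothesis `τ(X) ≤ ζ(Z)` of the dimension count. -/
theorem comap_span_le (hr : ∀ e, rk (Φ e) ≤ rk (Φ e₀)) {z : U} (hz : Φ e₀ z = 0)
    (hfull : LinearMap.range (Φ.flip z) = LinearMap.range (Φ e₀)) (x : U) :
    (K ∙ Φ e₀ x).comap (Φ.flip z) ≤
      (((LinearMap.range (Φ.flip z)).comap (Φ.flip x)).map (Φ.flip z)).comap (Φ.flip x) := by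
  set G := (((LinearMap.range (Φ.flip z)).comap (Φ.flip x)).map (Φ.flip z)).comap (Φ.flip x) with hG
  have key : ∀ e, Φ e z = Φ e₀ x → e ∈ G := fun e he => by
    have h1 : Φ e x ∈ LinearMap.range (Φ e₀) :=
      apply_mem_range₂ (rk_pencil_le Φ hr e) hz he.symm
    obtain ⟨e₂, he₂⟩ := hfull.symm ▸ h1
    obtain ⟨v, hv⟩ := h1
    refine ⟨e₂, ?_, he₂⟩
    have h2 : Φ e v ∈ LinearMap.range (Φ e₀) :=
      apply_mem_range₃ (rk_pencil_le Φ hr e) hz he.symm hv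
    have h3 := add_mem_range Φ hr hz (e := e₂) (e' := e) (u₁ := v) (u₂ := x) (hv.trans he₂.symm)
      he.symm
    change Φ e₂ x ∈ LinearMap.range (Φ.flip z)
    rw [hfull]
    exact (Submodule.add_mem_iff_left _ h2).1 h3
  obtain ⟨e₁, he₁⟩ : Φ e₀ x ∈ LinearMap.range (Φ.flip z) := hfull ▸ LinearMap.mem_range_self _ _
  have he₁' : Φ e₁ z = Φ e₀ x := he₁
  intro e he
  obtain ⟨c, hc⟩ := Submodule.mem_span_singleton.1 he
  have hc' : c • Φ e₀ x = Φ e z := hc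
  -- `key` covers only an affine subspace of the preimage; `e` is a linear combination of two of its
  -- elements.
  have h1 := key (e - c • e₁ + e₁) (by simp [he₁', hc'])
  have h2 := key e₁ he₁'
  have := G.add_mem (G.sub_mem h1 h2) (G.smul_mem c h2)
  simpa using this

theorem finrank_range_flip_le_of_full [FiniteDimensional K E] (hr : ∀ e, rk (Φ e) ≤ rk (Φ e₀))
    {z : U} (hz : Φ e₀ z = 0) (hfull : LinearMap.range (Φ.flip z) = LinearMap.range (Φ e₀)) (x : U) :
    rk (Φ.flip x) ≤ rk (Φ e₀) ∨ 2 * rk (Φ.flip x) + 1 ≤ 3 * rk (Φ e₀) := by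
  by_cases hx : Φ e₀ x = 0
  · exact .inl (Submodule.finrank_mono (range_flip_le Φ hr hx))
  right
  have hle := comap_span_le Φ hr hz hfull x
  have h := two_mul_finrank_range_add_le (Φ.flip x) (Φ.flip z)
    (hle.trans (Submodule.comap_mono (LinearMap.map_le_range)))
    (LinearMap.ker_le_comap _) (Submodule.map_le_iff_le_comap.2 hle)
  rw [Submodule.map_comap_eq_of_le, finrank_span_singleton hx, hfull] at h
  · exact h
  · rw [hfull, Submodule.span_singleton_le_iff_mem]
    exact LinearMap.mem_range_self _ _

/-- If `Φ e₀ x` lies on the line of `Φ e₁ z`, polarization against `e₁` already confines `Φ.flip x`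
to `range (Φ e₀)`. Otherwise `X` can be enlarged by `e₁`, so that `ζ(X)` is a plane instead of a
line and the estimate gains one. -/
theorem finrank_range_flip_le_of_full_of_rank_one [FiniteDimensional K E]
    (hr : ∀ e, rk (Φ e) ≤ rk (Φ e₀)) {z : U} (hz : Φ e₀ z = 0)
    (hfull : LinearMap.range (Φ.flip z) = LinearMap.range (Φ e₀)) {e₁ : E} (h₁ : Φ e₁ z ≠ 0)
    (hrange : LinearMap.range (Φ e₁) ≤ K ∙ Φ e₁ z) (x : U) :
    rk (Φ.flip x) ≤ rk (Φ e₀) ∨ 2 * rk (Φ.flip x) + 2 ≤ 3 * rk (Φ e₀) := by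
  have hy : Φ e₁ z ∈ LinearMap.range (Φ e₀) := hfull ▸ ⟨e₁, rfl⟩
  by_cases hx : ∃ c : K, c • Φ e₁ z = Φ e₀ x
  · obtain ⟨c, hc⟩ := hx
    left
    refine Submodule.finrank_mono ?_
    rintro _ ⟨e, rfl⟩
    obtain ⟨u, hu⟩ : Φ e z ∈ LinearMap.range (Φ e₀) := hfull ▸ ⟨e, rfl⟩
    have h := add_mem_range Φ hr hz (e := e) (e' := c • e₁) hu (u₂ := x) (by simp [hc])
    refine (Submodule.add_mem_iff_left _ ?_).1 h
    rw [map_smul, LinearMap.smul_apply]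
    exact Submodule.smul_mem _ _
      ((hrange.trans ((Submodule.span_singleton_le_iff_mem _ _).2 hy)) ⟨u, rfl⟩)
  right
  push Not at hx
  have hle := comap_span_le Φ hr hz hfull x
  set G := (((LinearMap.range (Φ.flip z)).comap (Φ.flip x)).map (Φ.flip z)).comap (Φ.flip x) with hG
  have he₁ : e₁ ∈ G := by
    obtain ⟨c, hc⟩ := Submodule.mem_span_singleton.1 (hrange ⟨x, rfl⟩)
    have hc' : Φ e₁ x = Φ.flip z (c • e₁) := by simp [hc]
    refine ⟨c • e₁, ?_, hc'.symm⟩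
    refine Submodule.smul_mem _ _ ?_
    change Φ e₁ x ∈ LinearMap.range (Φ.flip z)
    rw [hc']
    exact LinearMap.mem_range_self _ _
  have hle' : (Submodule.span K {Φ e₁ z, Φ e₀ x}).comap (Φ.flip z) ≤ G := by
    intro e he
    obtain ⟨a, b, hab⟩ := Submodule.mem_span_pair.1 he
    have hab' : a • Φ e₁ z + b • Φ e₀ x = Φ e z := hab
    have h := hle (x := e - a • e₁) (Submodule.mem_span_singleton.2 ⟨b, by simp [← hab']⟩)
    have := G.add_mem h (G.smul_mem a he₁)
    simpa using this
  have h := two_mul_finrank_range_add_le (Φ.flip x) (Φ.flip z)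
    (hle'.trans (Submodule.comap_mono (LinearMap.map_le_range)))
    (LinearMap.ker_le_comap _) (Submodule.map_le_iff_le_comap.2 hle')
  have hind : LinearIndependent K ![Φ e₁ z, Φ e₀ x] := (LinearIndependent.pair_iff' h₁).2 hx
  have h2 := finrank_span_eq_card hind
  rw [Matrix.range_cons_cons_empty, Fintype.card_fin] at h2
  rw [Submodule.map_comap_eq_of_le, h2, hfull] at h
  · exact h
  · rw [hfull, Submodule.span_le]
    rintro _ (rfl | rfl)
    · exact hy
    · exact LinearMap.mem_range_self _ _

end FullColumn

end OpSpace

namespace OpSpace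

open Module LinearMap Filter

/-! ### Generic conditions without a Zariski topology. -/

section OpenConditions

variable {K : Type*} [Field K] {E : Type*} [AddCommGroup E] [Module K E]

/-- Conical conditions that hold at almost all points of each line through a point where they hold. -/
structure OpenCond (P : E → Prop) : Prop where
  eventually : ∀ e₀ e₁, P e₀ → ∀ᶠ t : K in cofinite, P (e₀ + t • e₁)
  smul : ∀ (c : K) e, c ≠ 0 → P e → P (c • e)

/-- By homogeneity `e₀ + t • e₁` is as good as `e₁ + t⁻¹ • e₀`, so one line through both points
serves both conditions. -/
theorem OpenCond.exists_and [Infinite K] {P Q : E → Prop} (hP : OpenCond (K := K) P)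
    (hQ : OpenCond (K := K) Q) {e₀ e₁ : E} (h₀ : P e₀) (h₁ : Q e₁) : ∃ e, P e ∧ Q e := by
  have hinv : Tendsto (fun t : K => t⁻¹) cofinite cofinite := inv_injective.tendsto_cofinite
  have hne : ∀ᶠ t : K in cofinite, t ≠ 0 := (Set.finite_singleton (0 : K)).eventually_cofinite_notMem
  obtain ⟨t, h1, h2, h3⟩ := ((hP.eventually e₀ e₁ h₀).and
    ((hinv.eventually (hQ.eventually e₁ e₀ h₁)).and hne)).exists
  refine ⟨e₀ + t • e₁, h1, ?_⟩
  have := hQ.smul t _ h3 h2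
  rwa [smul_add, smul_smul, mul_inv_cancel₀ h3, one_smul, add_comm] at this

variable {X Y : Type*} [AddCommGroup X] [Module K X] [AddCommGroup Y] [Module K Y]

theorem openCond_ne_zero (F : E →ₗ[K] Y) : OpenCond (K := K) fun e => F e ≠ 0 where
  eventually e₀ e₁ h := by
    refine Set.Subsingleton.finite fun a ha b hb => ?_
    simp only [Set.mem_compl_iff, Set.mem_ofPred_eq, not_not, map_add, map_smul] at ha hb
    by_contra hab
    have h1 : (a - b) • F e₁ = 0 := by
      rw [sub_smul, ← add_sub_add_left_eq_sub _ _ (F e₀), ha, hb, sub_self]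
    rw [smul_eq_zero, sub_eq_zero] at h1
    simp [h1.resolve_left hab] at ha
    exact h ha
  smul c e hc h := by simp [hc, h]

theorem openCond_le_rk [FiniteDimensional K Y] (F : E →ₗ[K] X →ₗ[K] Y) (k : ℕ) :
    OpenCond (K := K) fun e => k ≤ rk (F e) where
  eventually e₀ e₁ h := by
    refine (finite_rk_lt (F e₀) (F e₁)).subset fun t ht => ?_
    simp only [Set.mem_compl_iff, Set.mem_ofPred_eq, not_le, map_add, map_smul] at ht ⊢
    omega
  smul c e hc h := by
    rw [map_smul, rk, LinearMap.range_smul _ _ hc]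
    exact h

end OpenConditions

/-! ### Semi-primitive families and their quotients. -/

section SemiPrimitive

variable {K : Type*} [Field K] {E U V : Type*}
  [AddCommGroup E] [Module K E] [AddCommGroup U] [Module K U] [AddCommGroup V] [Module K V]

/-- Vectors annihilated by an operator of rank `r`. -/
def IsGood (Φ : E →ₗ[K] U →ₗ[K] V) (r : ℕ) (z : U) : Prop := ∃ e, rk (Φ e) = r ∧ Φ e z = 0

/-- A linear family of operators of upper-rank `r` in which the kernels of the operators of rank `r`
span the source space. -/
structure SemiPrim (Φ : E →ₗ[K] U →ₗ[K] V) (r : ℕ) : Prop where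
  rk_le : ∀ e, rk (Φ e) ≤ r
  exists_rk : ∃ e, rk (Φ e) = r
  span_good : Submodule.span K {z | IsGood Φ r z} = ⊤

/-- The family induced by `Φ` with values in `V ⧸ Y`. -/
noncomputable abbrev quot (Φ : E →ₗ[K] U →ₗ[K] V) (Y : Submodule K V) : E →ₗ[K] U →ₗ[K] V ⧸ Y :=
  Φ.compr₂ Y.mkQ

/-- The restrictions to `W` of the operators of a linear family. -/
noncomputable abbrev res (Φ : E →ₗ[K] U →ₗ[K] V) (W : Submodule K U) : E →ₗ[K] W →ₗ[K] V :=
  Φ.compl₂ W.subtype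

/-- The sum of the ranges of the operators of a linear family. -/
noncomputable def total (Φ : E →ₗ[K] U →ₗ[K] V) : Submodule K V := ⨆ x, LinearMap.range (Φ.flip x)

theorem mem_total (Φ : E →ₗ[K] U →ₗ[K] V) (e : E) (x : U) : Φ e x ∈ total Φ :=
  Submodule.mem_iSup_of_mem x ⟨e, rfl⟩

theorem total_quot (Φ : E →ₗ[K] U →ₗ[K] V) (Y : Submodule K V) :
    total (quot Φ Y) = (total Φ).map Y.mkQ := by
  rw [total, total, Submodule.map_iSup]
  refine iSup_congr fun x => ?_
  rw [← LinearMap.range_comp]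
  rfl

theorem map_eq_range_of_isCoatom {f : U →ₗ[K] V} {H : Submodule K U} (hH : IsCoatom H) {z : U}
    (hz : z ∉ H) (hfz : f z = 0) : H.map f = LinearMap.range f := by
  refine le_antisymm LinearMap.map_le_range ?_
  rintro _ ⟨u, rfl⟩
  have htop : H ⊔ K ∙ z = ⊤ := hH.2 _ (by simpa [left_lt_sup] using hz)
  obtain ⟨h, hh, y, hy, rfl⟩ := Submodule.mem_sup.1 (htop ▸ Submodule.mem_top : u ∈ H ⊔ K ∙ z)
  obtain ⟨c, rfl⟩ := Submodule.mem_span_singleton.1 hy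
  exact ⟨h, hh, by simp [hfz]⟩

variable {Φ : E →ₗ[K] U →ₗ[K] V} {r : ℕ}

theorem SemiPrim.exists_notMem (hΦ : SemiPrim Φ r) {H : Submodule K U} (hH : H ≠ ⊤) :
    ∃ z ∉ H, IsGood Φ r z := by
  by_contra! h
  refine hH (top_le_iff.1 (hΦ.span_good ▸ Submodule.span_le.2 fun z hz => ?_))
  by_contra hzH
  exact h z hzH hz

theorem SemiPrim.exists_good_ne_zero (hΦ : SemiPrim Φ r) (hr : r ≠ 0) :
    ∃ z, IsGood Φ r z ∧ Φ.flip z ≠ 0 := by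
  obtain ⟨e, he⟩ := hΦ.exists_rk
  have hker : LinearMap.ker Φ.flip ≠ ⊤ := fun h => by
    have : Φ e = 0 := by
      ext x
      have : Φ.flip x = 0 := LinearMap.mem_ker.1 (h ▸ Submodule.mem_top)
      exact LinearMap.congr_fun this e
    rw [this] at he
    rw [rk, LinearMap.range_zero, finrank_bot] at he
    exact hr he.symm
  obtain ⟨z, hz, hg⟩ := hΦ.exists_notMem hker
  exact ⟨z, hg, fun h => hz h⟩

theorem SemiPrim.exists_rk_res (hΦ : SemiPrim Φ r) {H : Submodule K U} (hH : IsCoatom H) :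
    ∃ e, r ≤ rk (res Φ H e) := by
  obtain ⟨z, hz, e, he, hez⟩ := hΦ.exists_notMem hH.1
  refine ⟨e, ?_⟩
  have : LinearMap.range (res Φ H e) = LinearMap.range (Φ e) := by
    rw [← map_eq_range_of_isCoatom hH hz hez]
    change LinearMap.range (Φ e ∘ₗ H.subtype) = _
    rw [LinearMap.range_comp, Submodule.range_subtype]
  rw [rk, this, ← he]

variable [FiniteDimensional K V]

theorem exists_max_rk (Φ : E →ₗ[K] U →ₗ[K] V) :
    ∃ r, (∀ e, rk (Φ e) ≤ r) ∧ ∃ e, rk (Φ e) = r := by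
  have hb : BddAbove (Set.range fun e => rk (Φ e)) :=
    ⟨finrank K V, by rintro _ ⟨e, rfl⟩; exact Submodule.finrank_le _⟩
  obtain ⟨e, he⟩ := Nat.sSup_mem (Set.range_nonempty _) hb
  exact ⟨_, fun e => le_csSup hb ⟨e, rfl⟩, e, he⟩

theorem rk_quot_add (Φ : E →ₗ[K] U →ₗ[K] V) (Y : Submodule K V) (e : E) :
    rk (quot Φ Y e) + finrank K ↥(LinearMap.range (Φ e) ⊓ Y) = rk (Φ e) :=
  rk_mkQ_comp_add (Φ e) Y

theorem rk_quot_flip_add (Φ : E →ₗ[K] U →ₗ[K] V) (Y : Submodule K V) (x : U) :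
    rk ((quot Φ Y).flip x) + finrank K ↥(LinearMap.range (Φ.flip x) ⊓ Y) = rk (Φ.flip x) :=
  rk_mkQ_comp_add (Φ.flip x) Y

theorem rk_flip_le (Φ : E →ₗ[K] U →ₗ[K] V) (Y : Submodule K V) (x : U) :
    rk (Φ.flip x) ≤ finrank K Y + rk ((quot Φ Y).flip x) := by
  have h := rk_quot_flip_add Φ Y x
  have : finrank K ↥(LinearMap.range (Φ.flip x) ⊓ Y) ≤ finrank K Y :=
    Submodule.finrank_mono inf_le_right
  omega

theorem finrank_total_le (Φ : E →ₗ[K] U →ₗ[K] V) (Y : Submodule K V) :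
    finrank K (total Φ) ≤ finrank K Y + finrank K (total (quot Φ Y)) := by
  have h := rk_mkQ_comp_add (total Φ).subtype Y
  rw [rk, rk, LinearMap.range_comp, Submodule.range_subtype, ← total_quot] at h
  have : finrank K ↥(total Φ ⊓ Y) ≤ finrank K Y := Submodule.finrank_mono inf_le_right
  omega

theorem rk_flip_le_finrank_total (Φ : E →ₗ[K] U →ₗ[K] V) (x : U) :
    rk (Φ.flip x) ≤ finrank K (total Φ) :=
  Submodule.finrank_mono (le_iSup (fun x => LinearMap.range (Φ.flip x)) x)

theorem rk_res_le (Φ : E →ₗ[K] U →ₗ[K] V) (W : Submodule K U) (e : E) :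
    rk (res Φ W e) ≤ rk (Φ e) := by
  refine Submodule.finrank_mono ?_
  rintro _ ⟨u, rfl⟩
  exact ⟨u, rfl⟩

theorem exists_mem_ker_notMem {Φ : E →ₗ[K] U →ₗ[K] V} {H : Submodule K U} (hH : H ≠ ⊤) {e : E}
    (h : rk (Φ e) ≤ rk (res Φ H e)) : ∃ z ∉ H, Φ e z = 0 := by
  obtain ⟨u, -, hu⟩ := SetLike.exists_of_lt (lt_top_iff_ne_top.2 hH)
  have hle : LinearMap.range (res Φ H e) ≤ LinearMap.range (Φ e) := by
    rintro _ ⟨u, rfl⟩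
    exact ⟨u, rfl⟩
  obtain ⟨y, hy⟩ : Φ e u ∈ LinearMap.range (res Φ H e) :=
    (Submodule.eq_of_le_of_finrank_le hle h).symm ▸ LinearMap.mem_range_self _ _
  have hy' : Φ e y = Φ e u := hy
  exact ⟨u - y, fun hmem => hu (by simpa using H.add_mem hmem y.2), by simp [hy']⟩

theorem SemiPrim.rk_flip_le_of_isGood [Infinite K] (hΦ : SemiPrim Φ r) {z : U} (hz : IsGood Φ r z) :
    rk (Φ.flip z) ≤ r := by
  obtain ⟨e, rfl, hez⟩ := hz
  exact Submodule.finrank_mono (range_flip_le Φ hΦ.rk_le hez)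

theorem rk_flip_pos {z : U} (hz : Φ.flip z ≠ 0) : 0 < rk (Φ.flip z) := by
  rw [Nat.pos_iff_ne_zero, rk, Ne, Submodule.finrank_eq_zero, LinearMap.range_eq_bot]
  exact hz

variable [Infinite K]

/-- The rank drops because a generic `e` has `Φ e z ≠ 0`, a vector of `range (Φ e)` that dies in the
quotient. Spanning survives because, for each hyperplane `H`, a generic `e` has maximal rank in the
quotient as well as on `H`, hence a kernel vector outside `H`. -/
theorem SemiPrim.exists_semiPrim_quot (hΦ : SemiPrim Φ r) {z : U}
    (hz : Φ.flip z ≠ 0) : ∃ ρ < r, SemiPrim (quot Φ (LinearMap.range (Φ.flip z))) ρ := by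
  set Ψ := quot Φ (LinearMap.range (Φ.flip z)) with hΨ
  obtain ⟨ρ, hle, e₀, he₀⟩ := exists_max_rk Ψ
  refine ⟨ρ, ?_, hle, ⟨e₀, he₀⟩, ?_⟩
  · obtain ⟨e₁, he₁⟩ : ∃ e, Φ.flip z e ≠ 0 := by
      by_contra! h
      exact hz (LinearMap.ext h)
    obtain ⟨e, h1, h2⟩ := (openCond_le_rk Ψ ρ).exists_and (openCond_ne_zero (Φ.flip z)) he₀.ge he₁
    have h3 : rk (Ψ e) + _ = _ := rk_quot_add Φ (LinearMap.range (Φ.flip z)) e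
    have h4 : 0 < finrank K ↥(LinearMap.range (Φ e) ⊓ LinearMap.range (Φ.flip z)) := by
      rw [Nat.pos_iff_ne_zero, Ne, Submodule.finrank_eq_zero, Submodule.eq_bot_iff]
      exact fun h => h2 (h _ ⟨⟨z, rfl⟩, ⟨e, rfl⟩⟩)
    have := hΦ.rk_le e
    omega
  · rcases eq_top_or_exists_le_coatom (Submodule.span K {z | IsGood Ψ ρ z}) with h | ⟨H, hH, hle'⟩
    · exact h
    obtain ⟨e₁, he₁⟩ := hΦ.exists_rk_res hH
    obtain ⟨e, h1, h2⟩ := (openCond_le_rk Ψ ρ).exists_and (openCond_le_rk (res Φ H) r) he₀.ge he₁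
    obtain ⟨y, hy, hey⟩ := exists_mem_ker_notMem hH.1 ((hΦ.rk_le e).trans h2)
    refine absurd (hle' (Submodule.subset_span ⟨e, le_antisymm (hle e) h1, ?_⟩)) hy
    change Submodule.mkQ _ (Φ e y) = 0
    rw [hey, map_zero]

end SemiPrimitive

end OpSpace

namespace OpSpace

open Module LinearMap Filter

/-! ### Two maximal-rank operators in general position. -/

section Pairs

variable {K : Type*} [Field K] {E U V : Type*}
  [AddCommGroup E] [Module K E] [AddCommGroup U] [Module K U] [AddCommGroup V] [Module K V]
  [FiniteDimensional K V] {Φ : E →ₗ[K] U →ₗ[K] V}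

/-- Linear independence modulo the spaces `range (Φ.flip (w t))` is an open condition along a
polynomial curve `w`, as long as the dimensions of these spaces do not increase. -/
theorem eventually_linearIndependent_mkQ {w : K → U} (hw : IsPolyCurve w) {k : ℕ}
    {v : Fin k → K → V} (hv : ∀ i, IsPolyCurve (v i)) (t₀ : K)
    (h : LinearIndependent K fun i => (LinearMap.range (Φ.flip (w t₀))).mkQ (v i t₀)) :
    ∀ᶠ t in cofinite, rk (Φ.flip (w t₀)) ≤ rk (Φ.flip (w t)) ∧
      (rk (Φ.flip (w t)) = rk (Φ.flip (w t₀)) →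
        LinearIndependent K fun i => (LinearMap.range (Φ.flip (w t))).mkQ (v i t)) := by
  obtain ⟨a, ha, -⟩ := exists_lifts_of_rk_eq (f := Φ.flip (w t₀)) rfl
  have ha' : LinearIndependent K
      fun i => (⟨Φ.flip (w t₀) (a i), a i, rfl⟩ : LinearMap.range (Φ.flip (w t₀))) :=
    LinearIndependent.of_comp (Submodule.subtype _) ha
  have hsum := LinearIndependent.sumElim_of_quotient ha' (fun i => v i t₀) h
  let c : Fin (rk (Φ.flip (w t₀))) ⊕ Fin k → K → V :=
    Sum.elim (fun i t => Φ (a i) (w t)) v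
  have hc : ∀ i, IsPolyCurve (c i) := by
    rintro (i | i)
    · exact hw.map (Φ (a i))
    · exact hv i
  have h0 : LinearIndependent K fun i => c i t₀ := by
    have heq : (fun i => c i t₀) = Sum.elim (fun i => Φ.flip (w t₀) (a i)) fun i => v i t₀ := by
      funext i
      rcases i with i | i <;> rfl
    rw [heq]
    exact hsum
  refine (finite_not_linearIndependent hc h0).subset fun t ht => ?_
  by_contra hind
  refine ht ?_
  obtain ⟨h1, h2, h3⟩ := linearIndependent_sum.1 (not_not.1 hind)
  have hmem : ∀ i, ((fun i => c i t) ∘ Sum.inl) i ∈ LinearMap.range (Φ.flip (w t)) :=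
    fun i => ⟨a i, rfl⟩
  refine ⟨card_le_finrank_of_mem h1 hmem, fun heq => ?_⟩
  -- Equality of dimensions makes the transported vectors a basis of the whole space `range (Φ.flip
  -- (w t))`; without it, independence modulo that space could fail.
  have hspan : Submodule.span K (Set.range ((fun i => c i t) ∘ Sum.inl)) =
      LinearMap.range (Φ.flip (w t)) := by
    refine Submodule.eq_of_le_of_finrank_le (Submodule.span_le.2 ?_) ?_
    · rintro _ ⟨i, rfl⟩
      exact hmem i
    · rw [finrank_span_eq_card h1, Fintype.card_fin]
      exact heq.le
  refine LinearIndependent.map h2 ?_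
  rw [Submodule.ker_mkQ, ← hspan]
  exact h3.symm

theorem exists_kernel_path {r : ℕ} (hr : ∀ e, rk (Φ e) ≤ r) {e₀ e₁ : E} (h₀ : rk (Φ e₀) = r)
    (h₁ : rk (Φ e₁) = r) {z₀ z₁ : U} (hz₀ : Φ e₀ z₀ = 0) (hz₁ : Φ e₁ z₁ = 0) :
    ∃ w : K → U, IsPolyCurve w ∧ w 0 = z₀ ∧ w 1 = z₁ ∧
      ∀ᶠ t in cofinite, (Φ e₀ + t • Φ (e₁ - e₀)) (w t) = 0 := by
  have key : ∀ a b : E, rk (Φ a) = r → ∀ t : K, rk (Φ a + t • Φ b) ≤ rk (Φ a) := fun a b ha t => by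
    rw [ha]
    simpa using hr (a + t • b)
  obtain ⟨w₀, hw₀, h0, hf₀⟩ := exists_kernel_curve (key e₀ (e₁ - e₀) h₀) hz₀
  obtain ⟨w₁, hw₁, h1, hf₁⟩ := exists_kernel_curve (key e₁ (e₀ - e₁) h₁) hz₁
  have hinj : Function.Injective fun t : K => 1 - t := sub_right_injective
  -- Two kernel curves of the same pencil, one starting at each end, are interpolated.
  refine ⟨fun t => (1 - t) • w₀ t + t • w₁ (1 - t), ?_, by simp [h0], by simp [h1], ?_⟩
  · exact (IsPolyCurve.smul (IsPolyFun.id.comp_one_sub) hw₀).add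
      (IsPolyCurve.smul .id hw₁.comp_one_sub)
  · have h2 : ∀ᶠ t in cofinite, (Φ e₀ + t • Φ (e₁ - e₀)) (w₀ t) = 0 := by
      simpa [Filter.eventually_cofinite] using hf₀
    have h3 : ∀ᶠ t in cofinite, (Φ e₁ + t • Φ (e₀ - e₁)) (w₁ t) = 0 := by
      simpa [Filter.eventually_cofinite] using hf₁
    filter_upwards [h2, hinj.tendsto_cofinite.eventually h3] with t h4 h5
    have h6 : Φ e₁ + (1 - t) • Φ (e₀ - e₁) = Φ e₀ + t • Φ (e₁ - e₀) := by
      simp only [map_sub]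
      module
    rw [h6] at h5
    rw [map_add, map_smul, map_smul, h4, h5]
    simp

/-- Two operators of rank `s + 1` with kernel vectors in general position. -/
theorem SemiPrim.exists_pair [Infinite K] {s : ℕ} (hΦ : SemiPrim Φ (s + 1))
    (hs : ∀ z, IsGood Φ (s + 1) z → Φ.flip z ≠ 0 → rk (Φ.flip z) = s)
    (hq : ∀ z, IsGood Φ (s + 1) z → Φ.flip z ≠ 0 →
      ∃ e, s ≤ rk (quot Φ (LinearMap.range (Φ.flip z)) e)) :
    ∃ e z e' z', rk (Φ e) = s + 1 ∧ Φ e z = 0 ∧ rk (Φ e') = s + 1 ∧ Φ e' z' = 0 ∧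
      rk (Φ.flip z) = s ∧ rk (Φ.flip z') = s ∧
      Φ e z' ∉ LinearMap.range (Φ.flip z) ∧ Φ e' z ∉ LinearMap.range (Φ.flip z') ∧
      s ≤ rk (quot Φ (LinearMap.range (Φ.flip z)) e') := by
  obtain ⟨z₀, hg₀, hne⟩ := hΦ.exists_good_ne_zero (Nat.succ_ne_zero s)
  have hz₀ := hs z₀ hg₀ hne
  have hspos : 0 < s := hz₀ ▸ rk_flip_pos hne
  obtain ⟨e₀, he₀, hez₀⟩ := hg₀
  set Y := LinearMap.range (Φ.flip z₀) with hY
  have hker : LinearMap.ker (quot Φ Y e₀) ≠ ⊤ := fun h => by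
    have h1 := rk_quot_add Φ Y e₀
    have h2 : finrank K ↥(LinearMap.range (Φ e₀) ⊓ Y) ≤ finrank K Y :=
      Submodule.finrank_mono inf_le_right
    rw [LinearMap.ker_eq_top.1 h, rk, LinearMap.range_zero, finrank_bot] at h1
    have h3 : finrank K Y = s := hz₀
    omega
  -- `H` contains all vectors that `Φ e₀` sends into `Y`, so a kernel vector `z₁` of `Φ e₁` outside
  -- `H` satisfies `Φ e₀ z₁ ∉ Y`.
  obtain ⟨H, hH, hle⟩ := (eq_top_or_exists_le_coatom _).resolve_left hker
  obtain ⟨a, ha⟩ := hq z₀ ⟨e₀, he₀, hez₀⟩ hne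
  obtain ⟨b, hb⟩ := hΦ.exists_rk_res hH
  obtain ⟨e₁, h1, h2⟩ := (openCond_le_rk (quot Φ Y) s).exists_and
    (openCond_le_rk (res Φ H) (s + 1)) ha hb
  obtain ⟨z₁, hz₁, hez₁⟩ := exists_mem_ker_notMem hH.1 ((hΦ.rk_le e₁).trans h2)
  have he₁ : rk (Φ e₁) = s + 1 := le_antisymm (hΦ.rk_le e₁) (h2.trans (rk_res_le Φ H e₁))
  have hz₁Y : Y.mkQ (Φ e₀ z₁) ≠ 0 := fun h => hz₁ (hle h)
  obtain ⟨w, hw, hw0, hw1, hker'⟩ := exists_kernel_path hΦ.rk_le he₀ he₁ hez₀ hez₁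
  have hrk : ∀ᶠ t : K in cofinite, rk (Φ e₀ + t • Φ (e₁ - e₀)) = s + 1 := by
    refine (finite_rk_lt (Φ e₀) (Φ (e₁ - e₀))).subset fun t ht => ?_
    have h3 : rk (Φ e₀ + t • Φ (e₁ - e₀)) ≤ s + 1 := by simpa using hΦ.rk_le (e₀ + t • (e₁ - e₀))
    exact he₀.symm ▸ lt_of_le_of_ne h3 ht
  have hflip := Function.Injective.tendsto_cofinite (sub_right_injective (b := (1 : K)))
  -- Only one non-membership is known at `t = 0`. Pairing the parameters `t` and `1 - t` makes the
  -- two required conditions exchange under `t ↦ 1 - t`, so both hold for almost all `t`.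
  have hA := eventually_linearIndependent_mkQ (Φ := Φ) hw (k := 1)
    (v := fun _ t => (Φ e₀ + t • Φ (e₁ - e₀)) (w (1 - t)))
    (fun _ => IsPolyCurve.pencil _ _ hw.comp_one_sub) 0
    (by
      rw [linearIndependent_unique_iff]
      simpa [hw0, hw1, hY] using hz₁Y)
  obtain ⟨k, hk⟩ : ∃ k, rk (quot Φ Y e₁) = k := ⟨_, rfl⟩
  obtain ⟨u, hu, -⟩ := exists_lifts_of_rk_eq hk
  have hB := eventually_linearIndependent_mkQ (Φ := Φ) hw
    (v := fun i t => (Φ e₀ + (1 - t) • Φ (e₁ - e₀)) (u i))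
    (fun i => (IsPolyCurve.pencil (Φ e₀) (Φ (e₁ - e₀)) (.const (u i))).comp_one_sub) 0
    (by
      rw [hw0]
      simpa using hu)
  rw [hw0, hz₀] at hA hB
  obtain ⟨t, h3, h4, h5, h6, ⟨h7, h8⟩, ⟨h9, h10⟩, -, h11⟩ :=
    (hker'.and ((hflip.eventually hker').and (hrk.and ((hflip.eventually hrk).and
      (hA.and ((hflip.eventually hA).and hB)))))).exists
  have hlin : ∀ t : K, Φ e₀ + t • Φ (e₁ - e₀) = Φ (e₀ + t • (e₁ - e₀)) := by simp
  simp only [hlin] at h3 h4 h5 h6 h8 h10 h11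
  have hwt : ∀ t : K, rk (Φ (e₀ + t • (e₁ - e₀))) = s + 1 → Φ (e₀ + t • (e₁ - e₀)) (w t) = 0 →
      s ≤ rk (Φ.flip (w t)) → rk (Φ.flip (w t)) = s := fun t h h' h'' => by
    refine hs _ ⟨_, h, h'⟩ fun h0 => ?_
    rw [h0, rk, LinearMap.range_zero, finrank_bot] at h''
    omega
  have h12 := hwt t h5 h3 h7
  have h13 := hwt (1 - t) h6 h4 h9
  refine ⟨_, _, _, _, h5, h3, h6, h4, h12, h13, fun h => ?_, fun h => ?_, ?_⟩
  · exact (h8 h12).ne_zero 0 ((Submodule.Quotient.mk_eq_zero _).2 h)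
  · refine (h10 h13).ne_zero 0 ((Submodule.Quotient.mk_eq_zero _).2 ?_)
    simpa using h
  · refine h1.trans (hk.le.trans ?_)
    exact card_le_finrank_of_mem (h11 h12) fun i => ⟨u i, rfl⟩

/-- The bound for the dimension of `Φ.flip x` in presence of a pair of operators in general
position. -/
theorem SemiPrim.rk_flip_le_of_pair [Infinite K] [FiniteDimensional K E] {s : ℕ}
    (hΦ : SemiPrim Φ (s + 1)) {e e' : E} {z z' : U}
    (he : rk (Φ e) = s + 1) (hz : Φ e z = 0) (he' : rk (Φ e') = s + 1) (hz' : Φ e' z' = 0)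
    (hs : rk (Φ.flip z) = s) (hs' : rk (Φ.flip z') = s)
    (h : Φ e z' ∉ LinearMap.range (Φ.flip z)) (h' : Φ e' z ∉ LinearMap.range (Φ.flip z'))
    (hq : s ≤ rk (quot Φ (LinearMap.range (Φ.flip z)) e'))
    (hq' : ∀ a, rk (quot Φ (LinearMap.range (Φ.flip z)) a) ≤ s) (x : U) :
    rk (Φ.flip x) ≤ 2 * s ∨ 2 * rk (Φ.flip x) + 2 ≤ 5 * s := by
  set Y := LinearMap.range (Φ.flip z) with hY
  have hYs : finrank K Y = s := hs
  set Ψ := quot Φ Y with hΨ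
  have hΨe' : rk (Ψ e') = s := le_antisymm (hq' e') hq
  have hle : Y ≤ LinearMap.range (Φ e) := range_flip_le Φ (he.symm ▸ hΦ.rk_le) hz
  have hle' : LinearMap.range (Φ.flip z') ≤ LinearMap.range (Φ e') :=
    range_flip_le Φ (he'.symm ▸ hΦ.rk_le) hz'
  have h1 : rk (Ψ e) = 1 := by
    have : rk (Ψ e) + _ = _ := rk_quot_add Φ Y e
    rw [inf_eq_right.2 hle] at this
    omega
  have h2 : finrank K ↥(LinearMap.range (Φ e') ⊓ Y) = 1 := by
    have : rk (Ψ e') + _ = _ := rk_quot_add Φ Y e'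
    omega
  have hne : Φ e' z ≠ 0 := fun h0 => h' (h0 ▸ Submodule.zero_mem _)
  -- `range (Φ e') ⊓ Y` is the line of `Φ e' z`, and this vector avoids `range (Φ.flip z')`. So
  -- evaluation at `z'` loses no rank modulo `Y` and becomes full there.
  have hdisj : LinearMap.range (Φ.flip z') ⊓ Y = ⊥ := by
    rw [Submodule.eq_bot_iff]
    rintro v ⟨hv, hvY⟩
    have hmem : Φ e' z ∈ LinearMap.range (Φ e') ⊓ Y := ⟨⟨z, rfl⟩, ⟨e', rfl⟩⟩
    obtain ⟨c, hc⟩ := exists_smul_eq_of_finrank_eq_one h2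
      (x := ⟨Φ e' z, hmem⟩) (by simpa using hne) ⟨v, hle' hv, hvY⟩
    have hc' : c • Φ e' z = v := congrArg Subtype.val hc
    by_cases hc0 : c = 0
    · simp [← hc', hc0]
    · refine absurd ?_ h'
      rw [← inv_smul_smul₀ hc0 (Φ e' z), hc']
      exact Submodule.smul_mem _ _ hv
  have hΨz' : rk (Ψ.flip z') = s := by
    have : rk (Ψ.flip z') + _ = _ := rk_quot_flip_add Φ Y z'
    rw [hdisj, finrank_bot] at this
    omega
  have hr : ∀ a, rk (Ψ a) ≤ rk (Ψ e') := hΨe'.symm ▸ hq'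
  have hz'' : Ψ e' z' = 0 := by
    change Y.mkQ (Φ e' z') = 0
    rw [hz', map_zero]
  have hfull : LinearMap.range (Ψ.flip z') = LinearMap.range (Ψ e') :=
    Submodule.eq_of_le_of_finrank_le (range_flip_le Ψ hr hz'') (by
      change rk (Ψ e') ≤ rk (Ψ.flip z')
      omega)
  have hnz : Ψ e z' ≠ 0 := fun h0 => h ((Submodule.Quotient.mk_eq_zero _).1 h0)
  have hline : LinearMap.range (Ψ e) ≤ K ∙ Ψ e z' := by
    refine (Submodule.eq_of_le_of_finrank_le (S₁ := K ∙ Ψ e z') ?_ ?_).ge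
    · rw [Submodule.span_singleton_le_iff_mem]
      exact ⟨z', rfl⟩
    · rw [finrank_span_singleton hnz]
      exact h1.le
  have h3 := finrank_range_flip_le_of_full_of_rank_one Ψ hr hz'' hfull hnz hline x
  have h4 : _ ≤ _ + rk (Ψ.flip x) := rk_flip_le Φ Y x
  omega

end Pairs
end OpSpace

namespace OpSpace

open Module LinearMap

/-! ### Arithmetic of the bounds. -/

section Bounds

theorem two_mul_choose_two (n : ℕ) : 2 * (n + 1).choose 2 = (n + 1) * n := by
  induction n with
  | zero => rfl
  | succ n ih =>
    rw [Nat.choose_succ_succ' (n + 1) 1, Nat.choose_one_right, mul_add, ih]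
    ring

/-- The bound for the transitive rank of a semi-primitive space with upper-rank `r`. -/
def trkBound (r : ℕ) : ℕ := if r ≤ 1 then r else 3 + (r - 1).choose 2

theorem trkBound_add_two (n : ℕ) : trkBound (n + 2) = 3 + (n + 1).choose 2 := by
  simp [trkBound]

theorem two_mul_trkBound (n : ℕ) : 2 * trkBound (n + 2) = 6 + (n + 1) * n := by
  rw [trkBound_add_two, mul_add, two_mul_choose_two]

theorem trkBound_mono : Monotone trkBound := by
  refine monotone_nat_of_le_succ fun n => ?_
  match n with
  | 0 => simp [trkBound]
  | 1 => simp [trkBound]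
  | n + 2 =>
    have h1 := two_mul_trkBound n
    have h2 := two_mul_trkBound (n + 1)
    have : 2 * trkBound (n + 2) ≤ 2 * trkBound (n + 2 + 1) := by rw [h1, h2]; nlinarith
    omega

theorem le_trkBound_of_full {r t : ℕ} (h : t ≤ r ∨ 2 * t + 1 ≤ 3 * r) : t ≤ trkBound r := by
  match r with
  | 0 => simp [trkBound]; omega
  | 1 => simp [trkBound]; omega
  | n + 2 =>
    have h1 := two_mul_trkBound n
    -- Equality at `n = 1`, that is `r = 3`, where the additive constant `3` leaves no slack.
    have h2 : 2 * n ≤ 1 + n * n := by zify; nlinarith [sq_nonneg ((n : ℤ) - 1)]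
    have h3 : (n + 1) * n = n * n + n := by ring
    omega

/-- For `r ≥ 3` the bound grows by exactly `r - 2` from `r - 1` to `r`. -/
theorem add_trkBound_le {s ρ r : ℕ} (hs : s + 2 ≤ r) (hρ : ρ < r) (h0 : 0 < s) :
    s + trkBound ρ ≤ trkBound r := by
  obtain ⟨n, rfl⟩ : ∃ n, r = n + 3 := ⟨r - 3, by omega⟩
  have h1 := trkBound_mono (show ρ ≤ n + 2 by omega)
  have h2 := two_mul_trkBound n
  have h3 := two_mul_trkBound (n + 1)
  have h4 : (n + 1 + 1) * (n + 1) = (n + 1) * n + 2 * (n + 1) := by ring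
  change s + trkBound ρ ≤ trkBound (n + 1 + 2)
  omega

theorem add_trkBound_le' {s ρ : ℕ} (hρ : ρ < s) : s + trkBound ρ ≤ trkBound (s + 1) := by
  match s with
  | 0 => omega
  | 1 => obtain rfl : ρ = 0 := by omega
         simp [trkBound]
  | 2 => have := trkBound_mono (show ρ ≤ 1 by omega)
         simp [trkBound] at this ⊢
         omega
  | n + 3 =>
    have h1 := trkBound_mono (show ρ ≤ n + 2 by omega)
    have h2 := two_mul_trkBound n
    have h3 := two_mul_trkBound (n + 2)
    have h4 : (n + 2 + 1) * (n + 2) = (n + 1) * n + 4 * n + 6 := by ring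
    change n + 3 + trkBound ρ ≤ trkBound (n + 2 + 2)
    omega

theorem le_trkBound_of_pair {s t : ℕ} (hs : 0 < s) (h : t ≤ 2 * s ∨ 2 * t + 2 ≤ 5 * s) :
    t ≤ trkBound (s + 1) := by
  obtain ⟨n, rfl⟩ : ∃ n, s = n + 1 := ⟨s - 1, by omega⟩
  have h1 := two_mul_trkBound n
  -- This leaves `2 * t` at most one above `2 * trkBound (n + 2)`; parity absorbs the excess.
  have h2 : 4 * n ≤ 4 + n * n := by zify; nlinarith [sq_nonneg ((n : ℤ) - 2)]
  have h3 : (n + 1) * n = n * n + n := by ring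
  have h4 : 3 * n ≤ 2 + n * n := by
    rcases n with _ | _ | n
    · omega
    · omega
    · nlinarith
  change t ≤ trkBound (n + 2)
  omega

theorem add_choose_two_le {s ρ r : ℕ} (hs : s ≤ r) (hρ : ρ < r) :
    s + (ρ + 1).choose 2 ≤ (r + 1).choose 2 := by
  have h1 : (ρ + 1).choose 2 ≤ r.choose 2 := Nat.choose_le_choose 2 hρ
  have h2 : (r + 1).choose 2 = r.choose 1 + r.choose 2 := Nat.choose_succ_succ' r 1
  rw [Nat.choose_one_right] at h2
  omega

end Bounds

/-! ### The inductions over an infinite field. -/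

section Main

universe w

variable {K : Type*} [Field K] [Infinite K] {E U : Type*}
  [AddCommGroup E] [Module K E] [AddCommGroup U] [Module K U]

/-- Each quotient by a good column costs at most the current upper-rank, which then drops. The
target `V` is quantified inside because the induction replaces it by a quotient. -/
theorem SemiPrim.finrank_total_le_of_infinite (r : ℕ) : ∀ (V : Type w) [AddCommGroup V] [Module K V]
    [FiniteDimensional K V] (Φ : E →ₗ[K] U →ₗ[K] V), SemiPrim Φ r →
    finrank K (total Φ) ≤ (r + 1).choose 2 := by
  induction r using Nat.strong_induction_on with
  | _ r ih =>
    intro V _ _ _ Φ hΦ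
    rcases eq_or_ne r 0 with rfl | hr
    · have : total Φ = ⊥ := by
        rw [total, iSup_eq_bot]
        rintro x
        rw [eq_bot_iff]
        rintro _ ⟨e, rfl⟩
        have h := hΦ.rk_le e
        rw [Nat.le_zero, rk, Submodule.finrank_eq_zero, LinearMap.range_eq_bot] at h
        simp [h]
      simp [this]
    · obtain ⟨z, hz, hne⟩ := hΦ.exists_good_ne_zero hr
      obtain ⟨ρ, hρ, hΨ⟩ := hΦ.exists_semiPrim_quot hne
      have h1 := ih ρ hρ _ _ hΨ
      have h2 := finrank_total_le Φ (LinearMap.range (Φ.flip z))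
      have h3 : finrank K (LinearMap.range (Φ.flip z)) ≤ r := hΦ.rk_flip_le_of_isGood hz
      have h4 := add_choose_two_le h3 hρ
      omega

theorem SemiPrim.rk_flip_le_of_infinite [FiniteDimensional K E] (r : ℕ) : ∀ (V : Type w) [AddCommGroup V] [Module K V]
    [FiniteDimensional K V] (Φ : E →ₗ[K] U →ₗ[K] V), SemiPrim Φ r →
    ∀ x, rk (Φ.flip x) ≤ trkBound r := by
  induction r using Nat.strong_induction_on with
  | _ r ih =>
    intro V _ _ _ Φ hΦ x
    rcases eq_or_ne r 0 with rfl | hr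
    · have h1 : _ ≤ 0 := SemiPrim.finrank_total_le_of_infinite 0 V Φ hΦ
      have h2 := rk_flip_le_finrank_total Φ x
      omega
    have hstep : ∀ z, IsGood Φ r z → Φ.flip z ≠ 0 → ∃ ρ < r,
        SemiPrim (quot Φ (LinearMap.range (Φ.flip z))) ρ ∧
          rk (Φ.flip x) ≤ rk (Φ.flip z) + trkBound ρ := fun z hz hne => by
      obtain ⟨ρ, hρ, hΨ⟩ := hΦ.exists_semiPrim_quot hne
      exact ⟨ρ, hρ, hΨ, (rk_flip_le Φ (LinearMap.range (Φ.flip z)) x).trans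
        (Nat.add_le_add_left (ih ρ hρ _ _ hΨ x) _)⟩
    by_cases hfull : ∃ z, IsGood Φ r z ∧ rk (Φ.flip z) = r
    · obtain ⟨z, ⟨e, he, hez⟩, hz⟩ := hfull
      subst he
      refine le_trkBound_of_full (finrank_range_flip_le_of_full Φ hΦ.rk_le hez ?_ x)
      exact Submodule.eq_of_le_of_finrank_le (range_flip_le Φ hΦ.rk_le hez) hz.ge
    by_cases hsmall : ∃ z, IsGood Φ r z ∧ Φ.flip z ≠ 0 ∧ rk (Φ.flip z) + 2 ≤ r
    · obtain ⟨z, hz, hne, hle⟩ := hsmall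
      obtain ⟨ρ, hρ, -, h⟩ := hstep z hz hne
      exact h.trans (add_trkBound_le hle hρ (rk_flip_pos hne))
    push Not at hfull hsmall
    obtain ⟨s, rfl⟩ : ∃ s, r = s + 1 := ⟨r - 1, by omega⟩
    have hs : ∀ z, IsGood Φ (s + 1) z → Φ.flip z ≠ 0 → rk (Φ.flip z) = s := fun z hz hne => by
      have h1 := hfull z hz
      have h2 := hsmall z hz hne
      have h3 := hΦ.rk_flip_le_of_isGood hz
      omega
    by_cases hdrop : ∃ z, IsGood Φ (s + 1) z ∧ Φ.flip z ≠ 0 ∧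
        ∀ e, rk (quot Φ (LinearMap.range (Φ.flip z)) e) < s
    · obtain ⟨z, hz, hne, hlt⟩ := hdrop
      obtain ⟨ρ, hρ, hΨ, h⟩ := hstep z hz hne
      obtain ⟨e, he⟩ := hΨ.exists_rk
      rw [hs z hz hne] at h
      exact h.trans (add_trkBound_le' (he ▸ hlt e))
    push Not at hdrop
    obtain ⟨e, z, e', z', he, hez, he', hez', hsz, hsz', h, h', hq⟩ := hΦ.exists_pair hs hdrop
    have hne : Φ.flip z' ≠ 0 ∧ Φ.flip z ≠ 0 := by
      refine ⟨fun h0 => h ?_, fun h0 => h' ?_⟩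
      · have : Φ e z' = 0 := LinearMap.congr_fun h0 e
        exact this ▸ Submodule.zero_mem _
      · have : Φ e' z = 0 := LinearMap.congr_fun h0 e'
        exact this ▸ Submodule.zero_mem _
    obtain ⟨ρ, hρ, hΨ, -⟩ := hstep z ⟨e, he, hez⟩ hne.2
    refine le_trkBound_of_pair (hsz ▸ rk_flip_pos hne.2)
      (hΦ.rk_flip_le_of_pair he hez he' hez' hsz hsz' h h' hq (fun a => ?_) x)
    exact (hΨ.rk_le a).trans (Nat.lt_succ_iff.1 hρ)

end Main

end OpSpace

namespace OpSpace

open Module LinearMap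

/-! ### Rank through minors. -/

section Minors

variable {F L : Type*} [Field F] [Field L] {m n : Type*} [Fintype m] [Fintype n]

theorem exists_linearIndependent_rows {A : Matrix m n F} {k : ℕ} (h : k ≤ A.rank) :
    ∃ r : Fin k → m, LinearIndependent F fun i => A.row (r i) := by
  rw [A.rank_eq_finrank_span_row] at h
  obtain ⟨f, hf, -, hi⟩ := Submodule.exists_fun_fin_finrank_span_eq F (Set.range A.row)
  choose r hr using hf
  refine ⟨r ∘ Fin.castLE h, ?_⟩
  simpa [hr, Function.comp_def] using hi.comp _ (Fin.castLE_injective h)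

theorem le_rank_iff_exists_minor {A : Matrix m n F} {k : ℕ} :
    k ≤ A.rank ↔ ∃ (r : Fin k → m) (c : Fin k → n), (A.submatrix r c).det ≠ 0 := by
  constructor
  · intro h
    obtain ⟨r, hr⟩ := exists_linearIndependent_rows h
    have hB : (A.submatrix r _root_.id).rank = k := by
      simpa using LinearIndependent.rank_matrix (M := A.submatrix r _root_.id) hr
    rw [← Matrix.rank_transpose] at hB
    obtain ⟨c, hc⟩ := exists_linearIndependent_rows hB.ge
    refine ⟨r, c, ?_⟩
    have hu : IsUnit (A.submatrix r c).transpose :=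
      Matrix.linearIndependent_rows_iff_isUnit.1 hc
    rw [← Matrix.det_transpose]
    exact ((Matrix.isUnit_iff_isUnit_det _).1 hu).ne_zero
  · rintro ⟨r, c, h⟩
    have h1 := Matrix.rank_of_det_ne_zero h
    rw [Fintype.card_fin] at h1
    exact h1 ▸ A.rank_submatrix_le r c

theorem rank_map_eq (A : Matrix m n F) (φ : F →+* L) : (A.map φ).rank = A.rank := by
  have key : ∀ k, k ≤ (A.map φ).rank ↔ k ≤ A.rank := fun k => by
    simp only [le_rank_iff_exists_minor]
    refine exists_congr fun r => exists_congr fun c => ?_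
    have h : (A.map φ).submatrix r c = φ.mapMatrix (A.submatrix r c) := rfl
    rw [h, ← RingHom.map_det]
    exact map_ne_zero φ
  exact le_antisymm ((key _).1 le_rfl) ((key _).2 le_rfl)

end Minors

/-! ### Matrix families and extension of scalars. -/

section Coordinates

variable {F : Type*} [Field F] {a m n : ℕ}

/-- The linear family of operators `e ↦ ∑ i, e i • M i`. -/
noncomputable def family (M : Fin a → Matrix (Fin m) (Fin n) F) :
    (Fin a → F) →ₗ[F] (Fin n → F) →ₗ[F] (Fin m → F) :=
  (Matrix.toLin' : Matrix (Fin m) (Fin n) F ≃ₗ[F] _).toLinearMap ∘ₗ Fintype.linearCombination F M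

theorem family_apply (M : Fin a → Matrix (Fin m) (Fin n) F) (e : Fin a → F) (x : Fin n → F) :
    family M e x = (∑ i, e i • M i).mulVec x := by
  rw [family, LinearMap.comp_apply, Fintype.linearCombination_apply]
  rfl

theorem rk_family (M : Fin a → Matrix (Fin m) (Fin n) F) (e : Fin a → F) :
    rk (family M e) = (∑ i, e i • M i).rank := by
  rw [Matrix.rank, family, LinearMap.comp_apply, Fintype.linearCombination_apply]
  rfl

variable {L : Type*} [Field L] (φ : F →+* L) (M : Fin a → Matrix (Fin m) (Fin n) F)

theorem sum_map_smul (e : Fin a → F) :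
    ∑ i, φ (e i) • (M i).map φ = (∑ i, e i • M i).map φ := by
  ext j k
  simp [Matrix.sum_apply]

theorem family_map_apply (e : Fin a → F) (x : Fin n → F) :
    family (fun i => (M i).map φ) (φ ∘ e) (φ ∘ x) = φ ∘ family M e x := by
  simp only [family_apply, Function.comp_apply, sum_map_smul]
  exact funext fun i => (RingHom.map_mulVec φ _ _ i).symm

theorem rk_family_map (e : Fin a → F) :
    rk (family (fun i => (M i).map φ) (φ ∘ e)) = rk (family M e) := by
  simp only [rk_family, Function.comp_apply, sum_map_smul, rank_map_eq]

theorem finrank_span_le_of_map_mem {s : Set (Fin m → F)} {Y : Submodule L (Fin m → L)}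
    (h : ∀ v ∈ s, φ ∘ v ∈ Y) : finrank F (Submodule.span F s) ≤ finrank L Y := by
  obtain ⟨f, hf, -, hi⟩ := Submodule.exists_fun_fin_finrank_span_eq F s
  have h1 := LinearIndependent.rank_matrix (M := Matrix.of f) hi
  rw [Fintype.card_fin, ← rank_map_eq _ φ, Matrix.rank_eq_finrank_span_row] at h1
  rw [← h1]
  refine Submodule.finrank_mono (Submodule.span_le.2 ?_)
  rintro _ ⟨i, rfl⟩
  exact h _ (hf i)

theorem rk_flip_family_le (x : Fin n → F) :
    rk ((family M).flip x) ≤ rk ((family fun i => (M i).map φ).flip (φ ∘ x)) := by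
  have h := finrank_span_le_of_map_mem φ (s := Set.range ((family M).flip x))
    (Y := LinearMap.range ((family fun i => (M i).map φ).flip (φ ∘ x))) (by
      rintro _ ⟨e, rfl⟩
      exact ⟨φ ∘ e, family_map_apply φ M e x⟩)
  rwa [← LinearMap.coe_range, Submodule.span_eq] at h

theorem finrank_total_family_le :
    finrank F (total (family M)) ≤ finrank L (total (family fun i => (M i).map φ)) := by
  have h := finrank_span_le_of_map_mem φ (s := ⋃ x, Set.range ((family M).flip x))
    (Y := total (family fun i => (M i).map φ)) (by
      intro v hv
      obtain ⟨x, e, rfl⟩ := Set.mem_iUnion.1 hv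
      change φ ∘ family M e x ∈ _
      rw [← family_map_apply]
      exact mem_total _ _ _)
  have h2 : Submodule.span F (⋃ x, Set.range ((family M).flip x)) = total (family M) := by
    rw [Submodule.span_iUnion, total]
    refine iSup_congr fun x => ?_
    rw [← LinearMap.coe_range, Submodule.span_eq]
  rwa [h2] at h

/-- Over a field with more than `r` elements, the upper-rank is preserved by field extensions. -/
theorem rk_family_map_le {r : ℕ} (hcard : (r : Cardinal) < Cardinal.mk F)
    (hr : ∀ e, rk (family M e) ≤ r) (e : Fin a → L) :
    rk (family (fun i => (M i).map φ) e) ≤ r := by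
  by_contra! hlt
  rw [rk_family, ← Nat.succ_le_iff, le_rank_iff_exists_minor] at hlt
  obtain ⟨p, q, hpq⟩ := hlt
  -- The generic version of the offending minor, with indeterminate coefficients.
  let N : Matrix (Fin (r + 1)) (Fin (r + 1)) (MvPolynomial (Fin a) F) :=
    Matrix.of fun j k => ∑ i, MvPolynomial.X i * MvPolynomial.C (M i (p j) (q k))
  have hN : N.det.IsHomogeneous (r + 1) := by
    rw [Matrix.det_apply']
    refine MvPolynomial.IsHomogeneous.sum _ _ _ fun σ _ => ?_
    have h1 : MvPolynomial.IsHomogeneous (∏ i, N (σ i) i) (∑ _i : Fin (r + 1), 1) := by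
      refine MvPolynomial.IsHomogeneous.prod _ _ _ fun i _ => ?_
      change MvPolynomial.IsHomogeneous (∑ l, MvPolynomial.X l * MvPolynomial.C (M l (p (σ i)) (q i))) 1
      refine MvPolynomial.IsHomogeneous.sum _ _ _ fun l _ => ?_
      exact (MvPolynomial.isHomogeneous_X F l).mul (MvPolynomial.isHomogeneous_C _ _)
    have h2 : MvPolynomial.IsHomogeneous ((Equiv.Perm.sign σ : ℤ) : MvPolynomial (Fin a) F) 0 := by
      simpa using MvPolynomial.isHomogeneous_C (Fin a) ((Equiv.Perm.sign σ : ℤ) : F)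
    simpa using h2.mul h1
  have hzero : N.det = 0 := by
    -- Homogeneity is what lets `r + 1` field elements suffice in degree `r + 1`.
    refine hN.eq_zero_of_forall_eval_eq_zero_of_le_card (fun x => ?_) ?_
    · by_contra hne
      have h1 : r + 1 ≤ (∑ i, x i • M i).rank := by
        refine le_rank_iff_exists_minor.2 ⟨p, q, ?_⟩
        rw [RingHom.map_det] at hne
        convert hne using 2
        ext j k
        simp [N, Matrix.sum_apply]
      have h2 := hr x
      rw [rk_family] at h2
      omega
    · have := Order.succ_le_of_lt hcard
      rw [Cardinal.succ_natCast] at this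
      exact_mod_cast this
  apply hpq
  have h3 : MvPolynomial.eval₂Hom φ e N.det = 0 := by rw [hzero, map_zero]
  rw [RingHom.map_det] at h3
  rw [← h3]
  congr 1
  ext j k
  simp [N, Matrix.sum_apply]

theorem SemiPrim.family_map {r : ℕ} (hcard : (r : Cardinal) < Cardinal.mk F)
    (h : SemiPrim (family M) r) : SemiPrim (family fun i => (M i).map φ) r where
  rk_le := rk_family_map_le φ M hcard h.rk_le
  exists_rk := by
    obtain ⟨e, he⟩ := h.exists_rk
    exact ⟨φ ∘ e, by rw [rk_family_map, he]⟩
  span_good := by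
    set S := Submodule.span L {z | IsGood (family fun i => (M i).map φ) r z} with hS
    have h1 : ∀ v ∈ Submodule.span F {z | IsGood (family M) r z}, φ ∘ v ∈ S := by
      intro v hv
      induction hv using Submodule.span_induction with
      | mem z hz =>
        obtain ⟨e, he, hez⟩ := hz
        refine Submodule.subset_span ⟨φ ∘ e, by rw [rk_family_map, he], ?_⟩
        rw [family_map_apply, hez]
        ext
        simp
      | zero =>
        convert S.zero_mem
        ext
        simp
      | add x y _ _ hx hy =>
        convert S.add_mem hx hy
        ext
        simp
      | smul c x _ hx =>
        convert S.smul_mem (φ c) hx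
        ext
        simp
    rw [h.span_good] at h1
    rw [eq_top_iff, ← (Pi.basisFun L (Fin n)).span_eq, Submodule.span_le]
    rintro _ ⟨i, rfl⟩
    have h2 : Pi.basisFun L (Fin n) i = φ ∘ Pi.single i 1 := by
      ext j
      by_cases hij : j = i
      · subst hij
        simp
      · simp [Pi.single_eq_of_ne hij]
    rw [h2]
    exact h1 (Pi.single i 1) trivial

end Coordinates

/-! ### Descent to fields with more than `r` elements. -/

section BaseChange

variable {K : Type*} [Field K] {E U V E' U' V' : Type*}
  [AddCommGroup E] [Module K E] [AddCommGroup U] [Module K U] [AddCommGroup V] [Module K V]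
  [AddCommGroup E'] [Module K E'] [AddCommGroup U'] [Module K U'] [AddCommGroup V'] [Module K V']

section Equiv

variable {Φ : E →ₗ[K] U →ₗ[K] V} {Φ' : E' →ₗ[K] U' →ₗ[K] V'} (α : E ≃ₗ[K] E') (β : U ≃ₗ[K] U')
  (γ : V ≃ₗ[K] V') (h : ∀ e u, Φ' (α e) (β u) = γ (Φ e u))

theorem rk_congr {A B A' B' : Type*} [AddCommGroup A] [Module K A] [AddCommGroup B] [Module K B]
    [AddCommGroup A'] [Module K A'] [AddCommGroup B'] [Module K B'] {f : A →ₗ[K] B}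
    {f' : A' →ₗ[K] B'} (β : A ≃ₗ[K] A') (γ : B ≃ₗ[K] B') (h : ∀ u, f' (β u) = γ (f u)) :
    rk f' = rk f := by
  have h1 : LinearMap.range f' = (LinearMap.range f).map γ.toLinearMap := by
    ext v
    constructor
    · rintro ⟨u, rfl⟩
      refine ⟨f (β.symm u), ⟨_, rfl⟩, ?_⟩
      change γ _ = _
      rw [← h, LinearEquiv.apply_symm_apply]
    · rintro ⟨_, ⟨u, rfl⟩, rfl⟩
      exact ⟨β u, h u⟩
  rw [rk, h1, LinearEquiv.finrank_map_eq]

include h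

theorem SemiPrim.congr {r : ℕ} (hΦ : SemiPrim Φ r) : SemiPrim Φ' r where
  rk_le e := by
    have := hΦ.rk_le (α.symm e)
    rwa [← rk_congr β γ (h _), LinearEquiv.apply_symm_apply] at this
  exists_rk := by
    obtain ⟨e, he⟩ := hΦ.exists_rk
    exact ⟨α e, by rw [rk_congr β γ (h e), he]⟩
  span_good := by
    have h1 := congrArg (Submodule.map β.toLinearMap) hΦ.span_good
    rw [Submodule.map_top, LinearEquiv.range, Submodule.map_span] at h1
    rw [eq_top_iff, ← h1]
    refine Submodule.span_mono ?_
    rintro _ ⟨z, ⟨e, he, hez⟩, rfl⟩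
    exact ⟨α e, by rw [rk_congr β γ (h e), he], (h e z).trans (by rw [hez, map_zero])⟩

theorem finrank_total_congr : finrank K (total Φ') = finrank K (total Φ) := by
  have h1 : total Φ' = (total Φ).map γ.toLinearMap := by
    rw [total, total, Submodule.map_iSup, ← β.toEquiv.iSup_comp]
    refine iSup_congr fun u => ?_
    ext v
    constructor
    · rintro ⟨e, rfl⟩
      refine ⟨Φ (α.symm e) u, ⟨_, rfl⟩, ?_⟩
      change γ _ = Φ' e (β u)
      rw [← h, LinearEquiv.apply_symm_apply]
    · rintro ⟨_, ⟨e, rfl⟩, rfl⟩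
      exact ⟨α e, h e u⟩
  rw [h1, LinearEquiv.finrank_map_eq]

end Equiv

variable [FiniteDimensional K E] [FiniteDimensional K U] [FiniteDimensional K V]
  {Φ : E →ₗ[K] U →ₗ[K] V} {r : ℕ}

theorem SemiPrim.finrank_total_le_and_rk_flip_le (hcard : (r : Cardinal) < Cardinal.mk K) (hΦ : SemiPrim Φ r) :
    finrank K (total Φ) ≤ (r + 1).choose 2 ∧ ∀ x, rk (Φ.flip x) ≤ trkBound r := by
  let bE := finBasis K E
  let bU := finBasis K U
  let bV := finBasis K V
  let M := fun i => LinearMap.toMatrix bU bV (Φ (bE i))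
  let φ := algebraMap K (AlgebraicClosure K)
  have : Infinite (AlgebraicClosure K) := IsAlgClosed.instInfinite
  have h : ∀ e u, family M (bE.equivFun e) (bU.equivFun u) = bV.equivFun (Φ e u) := fun e u => by
    have h1 : ∑ i, bE.equivFun e i • M i = LinearMap.toMatrix bU bV (Φ e) := by
      conv_rhs => rw [← bE.sum_equivFun e]
      rw [map_sum, map_sum]
      simp only [map_smul, M]
    rw [family_apply, h1]
    exact LinearMap.toMatrix_mulVec_repr bU bV (Φ e) u
  have hM := (hΦ.congr _ _ _ h).family_map φ M hcard
  refine ⟨?_, fun x => ?_⟩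
  · rw [← finrank_total_congr _ _ _ h]
    exact (finrank_total_family_le φ M).trans (SemiPrim.finrank_total_le_of_infinite r _ _ hM)
  · have h1 : rk ((family M).flip (bU.equivFun x)) = rk (Φ.flip x) :=
      rk_congr bE.equivFun bV.equivFun fun e => h e x
    rw [← h1]
    exact (rk_flip_family_le φ M _).trans (SemiPrim.rk_flip_le_of_infinite r _ _ hM _)

end BaseChange

end OpSpace

namespace OpSpace

open Module LinearMap

/-! ### The column property and splitting off a semi-primitive part. -/

section ColumnProperty

universe w

variable {K : Type*} [Field K] {E U : Type*}
  [AddCommGroup E] [Module K E] [AddCommGroup U] [Module K U]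

section Hyperplanes

variable [FiniteDimensional K U] {V : Type*} [AddCommGroup V] [Module K V] [FiniteDimensional K V]

theorem finrank_le_finrank_add_one_of_isCoatom {H : Submodule K U} (hH : IsCoatom H) :
    finrank K U ≤ finrank K H + 1 := by
  obtain ⟨z, -, hz⟩ := SetLike.exists_of_lt (lt_top_iff_ne_top.2 hH.1)
  have htop : H ⊔ K ∙ z = ⊤ := hH.2 _ (by simpa [left_lt_sup] using hz)
  have h1 := Submodule.finrank_add_le_finrank_add_finrank H (K ∙ z)
  rw [htop, finrank_top] at h1
  have h2 : finrank K (K ∙ z) ≤ 1 := finrank_span_le_card {z} |>.trans (by simp)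
  omega

/-- A space of `c`-defective operators is semi-primitive if its restrictions to hyperplanes are not
`c`-defective. -/
theorem semiPrim_of_forall_isCoatom {Φ : E →ₗ[K] U →ₗ[K] V} {c : ℕ}
    (hc : ∀ e, rk (Φ e) + c ≤ finrank K U)
    (hH : ∀ H : Submodule K U, IsCoatom H → ∃ e, finrank K H < rk (res Φ H e) + c) :
    SemiPrim Φ (finrank K U - c) := by
  have hgood : ∀ H : Submodule K U, IsCoatom H →
      ∃ e, rk (Φ e) = finrank K U - c ∧ rk (Φ e) ≤ rk (res Φ H e) := fun H hco => by
    obtain ⟨e, he⟩ := hH H hco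
    have h1 := finrank_le_finrank_add_one_of_isCoatom hco
    have h2 := hc e
    have h3 := rk_res_le Φ H e
    exact ⟨e, by omega, by omega⟩
  refine ⟨fun e => ?_, ?_, ?_⟩
  · have := hc e
    omega
  · rcases eq_top_or_exists_le_coatom (⊥ : Submodule K U) with h | ⟨H, hco, -⟩
    · have h1 : finrank K U = 0 := by rw [← finrank_top, ← h, finrank_bot]
      refine ⟨0, ?_⟩
      have := hc 0
      omega
    · obtain ⟨e, he, -⟩ := hgood H hco
      exact ⟨e, he⟩
  · refine (eq_top_or_exists_le_coatom _).resolve_right ?_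
    rintro ⟨H, hco, hle⟩
    obtain ⟨e, he, hle'⟩ := hgood H hco
    obtain ⟨z, hz, hez⟩ := exists_mem_ker_notMem hco.1 hle'
    exact hz (hle (Submodule.subset_span ⟨e, he, hez⟩))

/-- `W` is a subspace of least dimension on which the family is still `c`-defective, so no
hyperplane of `W` has this property. -/
theorem exists_semiPrim_res {Φ : E →ₗ[K] U →ₗ[K] V} {c : ℕ}
    (hc : ∀ e, rk (Φ e) + c ≤ finrank K U) :
    ∃ W : Submodule K U, (∀ e, rk (res Φ W e) + c ≤ finrank K W) ∧
      SemiPrim (res Φ W) (finrank K W - c) := by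
  have htop : ∀ e, rk (res Φ ⊤ e) + c ≤ finrank K (⊤ : Submodule K U) := fun e => by
    rw [finrank_top]
    exact (Nat.add_le_add_right (rk_res_le Φ ⊤ e) c).trans (hc e)
  obtain ⟨W, hW, hmin⟩ := (measure fun W : Submodule K U => finrank K W).wf.has_min
    {W | ∀ e, rk (res Φ W e) + c ≤ finrank K W} ⟨⊤, htop⟩
  refine ⟨W, hW, semiPrim_of_forall_isCoatom hW fun H hco => ?_⟩
  by_contra! hle
  have hfin : finrank K (H.map W.subtype) = finrank K H :=
    (Submodule.equivMapOfInjective _ W.injective_subtype _).finrank_eq.symm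
  refine hmin (H.map W.subtype) (fun e => ?_) ?_
  · have hrange : LinearMap.range (Φ e ∘ₗ (H.map W.subtype).subtype) =
        LinearMap.range ((Φ e ∘ₗ W.subtype) ∘ₗ H.subtype) := by
      simp only [LinearMap.range_comp, Submodule.range_subtype, Submodule.map_comp]
    rw [hfin]
    change finrank K (LinearMap.range (Φ e ∘ₗ (H.map W.subtype).subtype)) + c ≤ finrank K H
    rw [hrange]
    exact hle e
  · change finrank K (H.map W.subtype) < finrank K W
    rw [hfin]
    exact Submodule.finrank_lt hco.1

end Hyperplanes

/-- The column property of a linear family of operators: the operators induced from `U ⧸ W` to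
`V ⧸ Y` are non-injective, for each proper subspace `W` whose images are included in `Y`. -/
def ColProp {V : Type*} [AddCommGroup V] [Module K V] (Φ : E →ₗ[K] U →ₗ[K] V) : Prop :=
  ∀ (W : Submodule K U) (Y : Submodule K V), W ≠ ⊤ → (∀ e, ∀ u ∈ W, Φ e u ∈ Y) →
    ∀ e, ∃ u ∉ W, Φ e u ∈ Y

/-- A pair `(W', Y')` for the quotient is pulled back to `W' ⊔ W`. If that is all of `U`, every
image already lies in `Y'`. -/
theorem ColProp.quot_total_res {V : Type*} [AddCommGroup V] [Module K V] {Φ : E →ₗ[K] U →ₗ[K] V}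
    (h : ColProp Φ) (W : Submodule K U) : ColProp (quot Φ (total (res Φ W))) := by
  set Y := total (res Φ W) with hY
  intro W' Y' hW' hY' e
  by_cases hsup : W' ⊔ W = ⊤
  · obtain ⟨u, -, hu⟩ := SetLike.exists_of_lt (lt_top_iff_ne_top.2 hW')
    refine ⟨u, hu, ?_⟩
    obtain ⟨a, ha, b, hb, rfl⟩ := Submodule.mem_sup.1 (hsup ▸ Submodule.mem_top : u ∈ W' ⊔ W)
    have h1 : quot Φ Y e b = 0 := (Submodule.Quotient.mk_eq_zero _).2 (mem_total (res Φ W) e ⟨b, hb⟩)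
    rw [map_add, h1, add_zero]
    exact hY' e a ha
  · obtain ⟨u, hu, hmem⟩ := h (W' ⊔ W) (Y'.comap Y.mkQ) hsup (fun e u hu => by
      obtain ⟨a, ha, b, hb, rfl⟩ := Submodule.mem_sup.1 hu
      have h1 : Y.mkQ (Φ e b) = 0 :=
        (Submodule.Quotient.mk_eq_zero _).2 (mem_total (res Φ W) e ⟨b, hb⟩)
      rw [Submodule.mem_comap, map_add, map_add, h1, add_zero]
      exact hY' e a ha) e
    exact ⟨u, fun h' => hu (Submodule.mem_sup_left h'), hmem⟩

theorem choose_two_add_le (a d : ℕ) :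
    (a + 1).choose 2 + (d + 1).choose 2 ≤ (a + (d + 1)).choose 2 := by
  have h1 := two_mul_choose_two a
  have h2 := two_mul_choose_two d
  have h3 := two_mul_choose_two (a + d)
  have h4 : (a + d + 1) * (a + d) = (a + 1) * a + (d + 1) * d + 2 * (a * d) := by ring
  have h5 : a + (d + 1) = a + d + 1 := rfl
  rw [h5]
  omega

theorem ColProp.finrank_total_le [FiniteDimensional K E] [FiniteDimensional K U] (r : ℕ) : ∀ (V : Type w) [AddCommGroup V]
    [Module K V] [FiniteDimensional K V] (Φ : E →ₗ[K] U →ₗ[K] V), ColProp Φ →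
    (∀ e, rk (Φ e) ≤ r) → (∃ e, rk (Φ e) = r) → (r : Cardinal) < Cardinal.mk K →
    finrank K (total Φ) ≤ (r + 1).choose 2 ∧
      (SemiPrim Φ r ∨ finrank K (total Φ) ≤ r.choose 2) := by
  induction r using Nat.strong_induction_on with
  | _ r ih =>
    intro V _ _ _ Φ hcol hle ⟨e₀, he₀⟩ hcard
    have hrn : r ≤ finrank K U := he₀ ▸ LinearMap.finrank_range_le _
    -- The exact defectiveness index, so that `W = ⊤` means `Φ` itself is semi-primitive with
    -- upper-rank `r`.
    obtain ⟨W, hW, hsp⟩ := exists_semiPrim_res (Φ := Φ) (c := finrank K U - r) fun e => by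
      have := hle e
      omega
    rcases eq_or_ne W ⊤ with rfl | hne
    · rw [finrank_top, Nat.sub_sub_self hrn] at hsp
      have hsp' : SemiPrim Φ r :=
        hsp.congr (.refl K E) Submodule.topEquiv (.refl K V) fun _ _ => rfl
      exact ⟨(hsp'.finrank_total_le_and_rk_flip_le hcard).1, .inl hsp'⟩
    suffices h : finrank K (total Φ) ≤ r.choose 2 from
      ⟨h.trans (Nat.choose_le_choose 2 (Nat.le_succ r)), .inr h⟩
    have hWlt := Submodule.finrank_lt hne
    have hW0 := hW 0
    obtain ⟨a, ha⟩ : ∃ a, finrank K W - (finrank K U - r) = a := ⟨_, rfl⟩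
    obtain ⟨d, hd⟩ : ∃ d, finrank K U = finrank K W + (d + 1) :=
      ⟨finrank K U - finrank K W - 1, by omega⟩
    obtain rfl : r = a + (d + 1) := by omega
    rw [ha] at hsp
    have h1 := (hsp.finrank_total_le_and_rk_flip_le (lt_of_le_of_lt (by exact_mod_cast Nat.le_add_right _ _) hcard)).1
    set Y := total (res Φ W) with hY
    obtain ⟨ρ, hρ, e₁, he₁⟩ := exists_max_rk (quot Φ Y)
    -- Here the column property acts: kernels in the quotient contain `W` strictly, so the rank is
    -- below the codimension `d + 1`. The unit gained turns `(r + 1).choose 2` into `r.choose 2`.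
    have hρd : ρ ≤ d := by
      obtain ⟨u, hu, huY⟩ := hcol W Y hne (fun e u hu => mem_total (res Φ W) e ⟨u, hu⟩) e₁
      have hlt : W < LinearMap.ker (quot Φ Y e₁) := by
        refine lt_of_le_of_ne (fun v hv => ?_) fun heq => hu (heq ▸ ?_)
        · exact (Submodule.Quotient.mk_eq_zero _).2 (mem_total (res Φ W) e₁ ⟨v, hv⟩)
        · exact (Submodule.Quotient.mk_eq_zero _).2 huY
      have h2 := Submodule.finrank_lt_finrank_of_lt hlt
      have h3 := (quot Φ Y e₁).finrank_range_add_finrank_ker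
      have h4 : finrank K (LinearMap.range (quot Φ Y e₁)) = ρ := he₁
      omega
    have h2 : finrank K (total (quot Φ Y)) ≤ _ := (ih ρ (by omega) _ _ (hcol.quot_total_res W) hρ ⟨e₁, he₁⟩
      (lt_of_le_of_lt (by exact_mod_cast (by omega)) hcard)).1
    have h3 : _ ≤ _ + finrank K (total (quot Φ Y)) := OpSpace.finrank_total_le Φ Y
    have h4 : (ρ + 1).choose 2 ≤ (d + 1).choose 2 := Nat.choose_le_choose 2 (by omega)
    have h5 := choose_two_add_le a d
    omega

end ColumnProperty

/-! ### Back to operator spaces, and the dual family. -/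

section OperatorSpaces

variable {K U V : Type*} [Field K] [AddCommGroup U] [Module K U]
  [AddCommGroup V] [Module K V] {T : Submodule K (U →ₗ[K] V)}

theorem finrank_eq_of_map_eq {A B : Type*} [AddCommGroup A] [Module K A] [AddCommGroup B]
    [Module K B] {σ : A →ₗ[K] B} (hσ : Function.Injective σ) {p : Submodule K A}
    {q : Submodule K B} (h : p.map σ = q) : finrank K p = finrank K q :=
  h ▸ (Submodule.equivMapOfInjective σ hσ p).finrank_eq

theorem orbit_eq_range (T : Submodule K (U →ₗ[K] V)) (x : U) :
    orbit T x = LinearMap.range (T.subtype.flip x) := by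
  ext v
  constructor
  · rintro ⟨f, hf, rfl⟩
    exact ⟨⟨f, hf⟩, rfl⟩
  · rintro ⟨f, rfl⟩
    exact ⟨f, f.2, rfl⟩

theorem trk_le {b : ℕ} (h : ∀ x, rk (T.subtype.flip x) ≤ b) : trk T ≤ b := by
  refine csSup_le ⟨_, 0, rfl⟩ ?_
  rintro _ ⟨x, rfl⟩
  rw [orbit_eq_range]
  exact h x

variable [FiniteDimensional K V]

theorem urk_spec (T : Submodule K (U →ₗ[K] V)) :
    (∀ f, rk (T.subtype f) ≤ urk T) ∧ ∃ f, rk (T.subtype f) = urk T := by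
  have hb : BddAbove {k : ℕ | ∃ f ∈ T, finrank K (LinearMap.range f) = k} :=
    ⟨finrank K V, by rintro _ ⟨f, -, rfl⟩; exact Submodule.finrank_le _⟩
  have hne : {k : ℕ | ∃ f ∈ T, finrank K (LinearMap.range f) = k}.Nonempty := ⟨_, 0, T.zero_mem, rfl⟩
  obtain ⟨f, hf, h⟩ := Nat.sSup_mem hne hb
  exact ⟨fun f => le_csSup hb ⟨f, f.2, rfl⟩, ⟨f, hf⟩, h⟩

theorem trkBound_of_two_le {r : ℕ} (hr : 2 ≤ r) : trkBound r = 3 + (r - 1).choose 2 :=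
  if_neg (by omega)

variable [FiniteDimensional K U]

theorem IsSemiPrimitive.semiPrim (h : IsSemiPrimitive T) : SemiPrim T.subtype (urk T) := by
  obtain ⟨-, c, hc, hc', hH⟩ := h
  have h1 : SemiPrim T.subtype (finrank K U - c) := by
    refine semiPrim_of_forall_isCoatom (fun f => ?_) fun H hco => ?_
    · have h2 := hc f f.2
      have h3 := (f : U →ₗ[K] V).finrank_range_add_finrank_ker
      change finrank K (LinearMap.range (f : U →ₗ[K] V)) + c ≤ _
      omega
    · have h2 := hH H (le_antisymm (Submodule.finrank_lt hco.1)
        (finrank_le_finrank_add_one_of_isCoatom hco))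
      simp only [IsDefective, not_forall, not_le] at h2
      obtain ⟨_, ⟨f, hf, rfl⟩, hlt⟩ := h2
      refine ⟨⟨f, hf⟩, ?_⟩
      have h3 := (LinearMap.domRestrict' H f).finrank_range_add_finrank_ker
      change _ < finrank K (LinearMap.range (LinearMap.domRestrict' H f)) + c
      omega
  obtain ⟨h2, f, hf⟩ := urk_spec T
  obtain ⟨g, hg⟩ := h1.exists_rk
  have h3 := h1.rk_le f
  have h4 := h2 g
  have h5 : finrank K U - c = urk T := by omega
  exact h5 ▸ h1

theorem SemiPrim.trk_le {r : ℕ} (h : SemiPrim T.subtype r) (hr : 2 ≤ r)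
    (hcard : (r : Cardinal) < Cardinal.mk K) : trk T ≤ 3 + (r - 1).choose 2 := by
  rw [← trkBound_of_two_le hr]
  exact OpSpace.trk_le (h.finrank_total_le_and_rk_flip_le hcard).2

theorem ColProp.trk_le (h : ColProp T.subtype) (hr : 4 ≤ urk T)
    (hcard : (urk T : Cardinal) < Cardinal.mk K) : trk T ≤ (urk T).choose 2 := by
  obtain ⟨hle, hex⟩ := urk_spec T
  rcases (h.finrank_total_le _ _ _ hle hex hcard).2 with h | h
  · refine (h.trk_le (by omega) hcard).trans ?_
    -- The semi-primitive bound is at most `r.choose 2` exactly when `3 ≤ r - 1`.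
    obtain ⟨k, hk⟩ : ∃ k, urk T = k + 4 := ⟨urk T - 4, by omega⟩
    have h1 : (k + 4).choose 2 = (k + 3).choose 1 + (k + 3).choose 2 :=
      Nat.choose_succ_succ' (k + 3) 1
    rw [hk, h1, Nat.choose_one_right]
    change 3 + (k + 3).choose 2 ≤ _
    omega
  · exact OpSpace.trk_le fun x => (rk_flip_le_finrank_total _ x).trans h

/-- In the dual family, with parameters in `U` and source `T`, being `c`-LLD means being
`c`-defective, and minimality forbids `c`-defective restrictions to hyperplanes of `T`. Evaluation
of the dual family at `f` is `f` itself. -/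
theorem urk_le_of_minimal_isLLD {c : ℕ} (hT : Minimal (IsLLD c) T) (hn : c + 2 ≤ finrank K T)
    (hcard : ((finrank K T - c : ℕ) : Cardinal) < Cardinal.mk K) :
    urk T ≤ 3 + (finrank K T - c - 1).choose 2 := by
  have hker : ∀ (H : Submodule K T) (x : U), finrank K (LinearMap.ker (res T.subtype.flip H x)) =
      finrank K ↥(H.map T.subtype ⊓
        LinearMap.ker (LinearMap.applyₗ x : (U →ₗ[K] V) →ₗ[K] V)) := fun H x => by
    refine finrank_eq_of_map_eq (K := K) (A := H) (B := U →ₗ[K] V) (σ := T.subtype ∘ₗ H.subtype)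
      (T.injective_subtype.comp H.injective_subtype) ?_
    ext f
    constructor
    · rintro ⟨g, hg, rfl⟩
      exact ⟨⟨g, g.2, rfl⟩, hg⟩
    · rintro ⟨⟨g, hg, rfl⟩, h⟩
      exact ⟨⟨g, hg⟩, h, rfl⟩
  have hsp : SemiPrim T.subtype.flip (finrank K T - c) := by
    refine semiPrim_of_forall_isCoatom (K := K) (E := U) (U := T) (V := V) (Φ := T.subtype.flip)
      (c := c) (fun x => ?_) fun H hco => ?_
    · have h1 := hT.prop x
      have h2 := (T.subtype.flip x).finrank_range_add_finrank_ker
      have h3 : finrank K (LinearMap.ker (T.subtype.flip x)) =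
          finrank K ↥(T ⊓ LinearMap.ker (LinearMap.applyₗ x : (U →ₗ[K] V) →ₗ[K] V)) := by
        refine finrank_eq_of_map_eq (K := K) (A := T) (B := U →ₗ[K] V) (σ := T.subtype) T.injective_subtype ?_
        ext f
        constructor
        · rintro ⟨g, hg, rfl⟩
          exact ⟨g.2, hg⟩
        · rintro ⟨hf, h⟩
          exact ⟨⟨f, hf⟩, h, rfl⟩
      change finrank K (LinearMap.range (T.subtype.flip x)) + c ≤ _
      omega
    · have hnot : ¬ IsLLD c (H.map T.subtype) := fun hlld => by
        have hle := hT.le_of_le hlld (Submodule.map_subtype_le T H)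
        refine hco.1 (top_le_iff.1 fun f _ => ?_)
        obtain ⟨g, hg, hgf⟩ := hle f.2
        rwa [← Subtype.ext hgf]
      simp only [IsLLD, not_forall, not_le] at hnot
      obtain ⟨x, hx⟩ := hnot
      rw [← hker] at hx
      refine ⟨x, ?_⟩
      have h2 := LinearMap.finrank_range_add_finrank_ker (K := K) (V := H) (V₂ := V)
        (res T.subtype.flip H x)
      change _ < finrank K (LinearMap.range (res T.subtype.flip H x)) + c
      omega
  rw [← trkBound_of_two_le (by omega)]
  obtain ⟨-, f, hf⟩ := urk_spec T
  rw [← hf]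
  exact (hsp.finrank_total_le_and_rk_flip_le hcard).2 f

end OperatorSpaces

/-! ### The column property of matrices in coordinate-free form. -/

section MatrixSpaces

variable {K : Type*} [Field K]

theorem exists_adapted_basis {V : Type*} [AddCommGroup V] [Module K V] [FiniteDimensional K V]
    {n : ℕ} (hn : finrank K V = n) (W : Submodule K V) :
    ∃ b : Basis (Fin n) K V, ∀ v, v ∈ W ↔ ∀ i, finrank K W ≤ i.val → b.repr v i = 0 := by
  obtain ⟨C, hC⟩ := Submodule.exists_isCompl W
  have hsum : finrank K W + finrank K C = n := by
    rw [Submodule.finrank_add_eq_of_isCompl hC, hn]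
  let ε := Submodule.prodEquivOfIsCompl W C hC
  let b₀ := ((finBasis K W).prod (finBasis K C)).map ε
  let b := b₀.reindex (finSumFinEquiv.trans (finCongr hsum))
  refine ⟨b, fun v => ?_⟩
  rw [← Submodule.prodEquivOfIsCompl_symm_apply_snd_eq_zero W C hC]
  have hrepr : ∀ j, b.repr v ((finCongr hsum) (Fin.natAdd _ j)) =
      (finBasis K C).repr (ε.symm v).2 j := fun j => by
    rw [Basis.repr_reindex_apply]
    simp [b₀]
  constructor
  · intro h i hi
    obtain ⟨j, rfl⟩ : ∃ j, (finCongr hsum) (Fin.natAdd _ j) = i :=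
      ⟨⟨i - finrank K W, by omega⟩, by ext; simp; omega⟩
    rw [hrepr]
    change (finBasis K C).repr ((Submodule.prodEquivOfIsCompl W C hC).symm v).2 j = 0
    rw [h, map_zero]
    rfl
  · intro h
    refine (finBasis K C).repr.injective ?_
    ext j
    have := h ((finCongr hsum) (Fin.natAdd _ j)) (by simp)
    rw [hrepr] at this
    rw [map_zero]
    exact this

/-- The invertible matrix of a linear automorphism of `K ^ n`. -/
noncomputable def glOfEquiv {n : ℕ} (ε : (Fin n → K) ≃ₗ[K] (Fin n → K)) : GL (Fin n) K where
  val := LinearMap.toMatrix' ε.toLinearMap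
  inv := LinearMap.toMatrix' ε.symm.toLinearMap
  val_inv := by rw [← LinearMap.toMatrix'_comp]; simp
  inv_val := by rw [← LinearMap.toMatrix'_comp]; simp

theorem glOfEquiv_mul_mul_mulVec {m n : ℕ} (ε : (Fin m → K) ≃ₗ[K] (Fin m → K))
    (δ : (Fin n → K) ≃ₗ[K] (Fin n → K)) (M : Matrix (Fin m) (Fin n) K) (v : Fin n → K) :
    ((glOfEquiv ε).val * M * (glOfEquiv δ).val).mulVec v = ε (M.mulVec (δ v)) := by
  rw [← Matrix.mulVec_mulVec, ← Matrix.mulVec_mulVec]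
  simp only [glOfEquiv, LinearMap.toMatrix'_mulVec]
  rfl

/-- In bases adapted to `W` and `Y`, the lower-left block represents the operators induced from `U ⧸
W` to `V ⧸ Y`, and a kernel vector of it, extended by zero, is the required `u`. -/
theorem HasColumnProperty.colProp {m n : ℕ} {S : Submodule K (Matrix (Fin m) (Fin n) K)}
    (h : HasColumnProperty S) : ColProp (K := K) (E := ofMatrices S) (U := Fin n → K) (V := Fin m → K) (ofMatrices S).subtype := by
  rintro W Y hW hY ⟨_, M, hM, rfl⟩
  have hdim : finrank K (Fin n → K) = n := by simp
  have hWn : finrank K W < n := by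
    have := Submodule.finrank_lt hW
    rwa [hdim] at this
  have hYm : finrank K Y ≤ m := (Submodule.finrank_le Y).trans (by simp)
  obtain ⟨bY, hbY⟩ := exists_adapted_basis (n := m) (by simp) Y
  obtain ⟨b, hb⟩ := exists_adapted_basis hdim W
  -- The zero block sits in the last columns, so the basis vectors of `W` must come last in the
  -- source but those of `Y` first in the target.
  let bW := b.reindex Fin.revPerm
  have hbW : ∀ v, v ∈ W ↔ ∀ i, i.val < n - finrank K W → bW.repr v i = 0 := fun v => by
    rw [hb]
    constructor
    · intro h i hi
      have := h i.rev (by rw [Fin.val_rev]; omega)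
      simpa [bW] using this
    · intro h i hi
      have := h i.rev (by rw [Fin.val_rev]; omega)
      simpa [bW] using this
  let P := glOfEquiv bY.equivFun
  let Q := glOfEquiv bW.equivFun.symm
  let L : Matrix (Fin m) (Fin n) K →ₗ[K] Matrix (Fin m) (Fin n) K :=
    { toFun := fun M => P.val * M * Q.val
      map_add' := fun A B => by rw [Matrix.mul_add, Matrix.add_mul]
      map_smul' := fun c A => by simp }
  have hL : ∀ A v, (L A).mulVec v = bY.equivFun (A.mulVec (bW.equivFun.symm v)) :=
    glOfEquiv_mul_mul_mulVec _ _
  have hdec : IsDecomposed (finrank K Y) (n - finrank K W) (S.map L) := by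
    rintro _ ⟨A, hA, rfl⟩ i j hi hj
    have h1 : L A i j = ((L A).mulVec (Pi.single j 1)) i := by simp
    rw [h1, hL]
    refine (hbY _).1 (hY ⟨_, A, hA, rfl⟩ _ ((hbW _).2 fun k hk => ?_)) i hi
    change bW.equivFun (bW.equivFun.symm _) k = 0
    rw [LinearEquiv.apply_symm_apply, Pi.single_eq_of_ne]
    rintro rfl
    omega
  have hdef := h (finrank K Y) (n - finrank K W) hYm (by omega) (by omega) (S.map L)
    ⟨P, Q, rfl⟩ hdec _ ⟨_, ⟨_, ⟨M, hM, rfl⟩, rfl⟩, rfl⟩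
  change 1 ≤ finrank K (LinearMap.ker (Matrix.toLin'
    (lowerBlock K m n (finrank K Y) (n - finrank K W) (L M)))) at hdef
  obtain ⟨v, hv, hv0⟩ := Submodule.exists_mem_ne_zero_of_ne_bot
    (fun h0 => by rw [h0, finrank_bot] at hdef; omega :
      LinearMap.ker (Matrix.toLin' (lowerBlock K m n (finrank K Y) (n - finrank K W) (L M))) ≠ ⊥)
  let v' : Fin n → K := fun j => if hj : j.val < n - finrank K W then v ⟨j, hj⟩ else 0
  refine ⟨bW.equivFun.symm v', fun hmem => hv0 ?_, ?_⟩
  · funext j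
    have h1 : bW.equivFun (bW.equivFun.symm v') j.1 = 0 := (hbW _).1 hmem j.1 j.2
    rw [LinearEquiv.apply_symm_apply] at h1
    simpa [v', j.2] using h1
  · refine (hbY _).2 fun i hi => ?_
    have h1 : bY.equivFun (M.mulVec (bW.equivFun.symm v')) i = 0 := by
      rw [← hL]
      have h2 := congrFun (LinearMap.mem_ker.1 hv) ⟨i, hi⟩
      rw [Matrix.toLin'_apply] at h2
      rw [Matrix.mulVec, dotProduct,
        ← Fintype.sum_subtype_add_sum_subtype (fun j : Fin n => j.val < n - finrank K W)]
      have h3 : ∑ j : {j : Fin n // ¬ j.val < n - finrank K W}, L M i j * v' j = 0 :=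
        Finset.sum_eq_zero fun j _ => by simp [v', j.2]
      rw [h3, add_zero]
      refine Eq.trans (Finset.sum_congr rfl fun j _ => ?_) h2
      have h4 : v' j = v j := by simp [v', j.2]
      rw [h4]
      rfl
    exact h1

end MatrixSpaces

end OpSpace

theorem mainTheorem7 {K : Type*} [Field K] :
    (∀ (m n : ℕ) (S : Submodule K (Matrix (Fin m) (Fin n) K)) (r : ℕ),
      OpSpace.IsReduced (OpSpace.ofMatrices S) →
      OpSpace.urk (OpSpace.ofMatrices S) = r →
      (r : Cardinal) < Cardinal.mk K → 2 ≤ r →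
      (OpSpace.HasColumnProperty S → 4 ≤ r →
        OpSpace.trk (OpSpace.ofMatrices S) ≤ r.choose 2) ∧
      (OpSpace.IsSemiPrimitive (OpSpace.ofMatrices S) →
        OpSpace.trk (OpSpace.ofMatrices S) ≤ 3 + (r - 1).choose 2)) ∧
    (∀ (U V : Type*) [AddCommGroup U] [Module K U] [FiniteDimensional K U]
        [AddCommGroup V] [Module K V] [FiniteDimensional K V]
        (S : Submodule K (U →ₗ[K] V)) (c n : ℕ),
      0 < c →
      Minimal (OpSpace.IsLLD c) S →
      Module.finrank K S = n →
      c + 2 ≤ n →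
      ((n - c : ℕ) : Cardinal) < Cardinal.mk K →
      OpSpace.urk S ≤ 3 + (n - c - 1).choose 2) := by
  refine ⟨fun m n S r _ hr hcard h2 => ?_, fun U V _ _ _ _ _ _ S c n _ hS hn hcn hcard => ?_⟩
  · subst hr
    exact ⟨fun hcol h4 => hcol.colProp.trk_le h4 hcard, fun h => h.semiPrim.trk_le h2 hcard⟩
  · subst hn
    exact OpSpace.urk_le_of_minimal_isLLD hS hcn hcard
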